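/- Proposition 3.3. An abelian complex structure on a real Lie algebra $\mathfrak s$ is a linear endomorphism $J$ of $\mathfrak s$ with $J^2=-\mathrm{Id}$ and $[Jx,Jy]=[x,y]$ for all $x,y\in\mathfrak s$. For a finite-dimensional real associative (not necessarily unital) algebra $A$, let $\mathfrak{aff}(A)$ be the real Lie algebra $A\oplus A$ with bracket $[(a,b),(a',b')]=(aa'-a'a,\;ab'-a'b)$. Let $\mathfrak z$ denote the center of $\mathfrak s$. (i) If $\mathfrak s$ is a $4$-dimensional real Lie algebra admitting an abelian complex structure, then $\mathfrak s/\mathfrak z$ is isomorphic, as a Lie algebra, to $\mathfrak{aff}(A)$ for some finite-dimensional commutative associative real algebra $A$. (ii) A real Lie algebra is $4$-dimensional and admits an abelian complex structure if and only if it is isomorphic to one of the following: - $S_0=\mathbb R^4$ (abelian); - $S_1=\mathfrak h_1\oplus\mathbb R$, a direct sum of ideals, where $\mathfrak h_1$ is the $3$-dimensional Heisenberg algebra; - $S_2=\mathfrak{aff}(\mathbb R)\oplus\mathbb R^2$, a direct sum of ideals; - $S_8=\mathfrak{aff}(\mathbb R)\oplus\mathfrak{aff}(\mathbb R)$, a direct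 sum of ideals; - $S_9=\mathfrak{aff}(\mathbb R)\ltimes_{\mathrm{ad}}\mathbb R^2$, where $\mathbb R^2$ is the vector space underlying $\mathfrak{aff}(\mathbb R)$, regarded as an abelian ideal on which $\mathfrak{aff}(\mathbb R)$ acts by the adjoint representation; - $S_{10}=\mathfrak{aff}(\mathbb R)\ltimes_{\mathrm{ad}}\mathfrak{aff}(\mathbb R)$, where $\mathfrak{aff}(\mathbb R)$ acts on the Lie algebra $\mathfrak{aff}(\mathbb R)$ by the adjoint representation; - $S_{11}=\mathfrak{aff}(\mathbb C)$, regarded as a real Lie algebra. (The list is not claimed to be free of repetitions.) (iii) The quotient of $S_i$ by its center is isomorphic to $\mathfrak{aff}(A_i)$ for the following commutative algebras $A_i$: $A_0=0$; $A_1=\mathbb R$ with the zero product; $A_2=\mathbb R$ with the usual product; and, with $a,b$ ranging over $\mathbb R$, $$A_8=\left\{\begin{pmatrix}a&0\\0&b\end{pmatrix}\right\},\quad A_9=\left\{\begin{pmatrix}a&0\\b&a\end{pmatrix}\right\},\quad A_{10}=\left\{\begin{pmatrix}a&b\\b&a\end{pmatrix}\right\};$$ and $A_{11}=\mathbb C$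 with the usual product. -/

import Mathlib

/-- An abelian complex structure on a real Lie algebra: `J² = -1` and `[Jx, Jy] = [x, y]`. -/
structure IsAbelianComplexStructure {s : Type*} [LieRing s] [LieAlgebra ℝ s]
    (J : s →ₗ[ℝ] s) : Prop where
  sq : ∀ x, J (J x) = -x
  lie : ∀ x y, ⁅J x, J y⁆ = ⁅x, y⁆

/-- The real Lie algebra `s` admits an abelian complex structure. -/
def AdmitsAbelianComplexStructure (s : Type*) [LieRing s] [LieAlgebra ℝ s] : Prop :=
  ∃ J : s →ₗ[ℝ] s, IsAbelianComplexStructure J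

/-- The vector space `A ⊕ A` underlying the Lie algebra `aff(A)`; its elements are the pairs
`(a, b)`. -/
@[ext] structure Aff (A : Type*) where
  fst : A
  snd : A

namespace Aff

/-- As a set, `aff(A)` is `A × A`. -/
def toProd {A : Type*} : Aff A ≃ A × A where
  toFun x := (x.fst, x.snd)
  invFun x := ⟨x.1, x.2⟩
  left_inv _ := rfl
  right_inv _ := rfl

variable {A : Type*} [NonUnitalRing A]

instance : AddCommGroup (Aff A) := toProd.addCommGroup

/-- `[(a, b), (a', b')] = (a a' - a' a, a b' - a' b)`. -/
instance : Bracket (Aff A) (Aff A) where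
  bracket x y := ⟨x.fst * y.fst - y.fst * x.fst, x.fst * y.snd - y.fst * x.snd⟩

@[simp] theorem zero_fst : (0 : Aff A).fst = 0 := rfl
@[simp] theorem zero_snd : (0 : Aff A).snd = 0 := rfl
@[simp] theorem add_fst (x y : Aff A) : (x + y).fst = x.fst + y.fst := rfl
@[simp] theorem add_snd (x y : Aff A) : (x + y).snd = x.snd + y.snd := rfl
@[simp] theorem lie_fst (x y : Aff A) : ⁅x, y⁆.fst = x.fst * y.fst - y.fst * x.fst := rfl
@[simp] theorem lie_snd (x y : Aff A) : ⁅x, y⁆.snd = x.fst * y.snd - y.fst * x.snd := rfl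

instance : LieRing (Aff A) where
  add_lie x y z := by ext <;> simp only [lie_fst, lie_snd, add_fst, add_snd] <;> noncomm_ring
  lie_add x y z := by ext <;> simp only [lie_fst, lie_snd, add_fst, add_snd] <;> noncomm_ring
  lie_self x := by ext <;> simp
  leibniz_lie x y z := by
    ext <;> simp only [lie_fst, lie_snd, add_fst, add_snd] <;> noncomm_ring

variable [Module ℝ A]

instance : Module ℝ (Aff A) := toProd.module ℝ

@[simp] theorem smul_fst (t : ℝ) (x : Aff A) : (t • x).fst = t • x.fst := rfl
@[simp] theorem smul_snd (t : ℝ) (x : Aff A) : (t • x).snd = t • x.snd := rfl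

instance [IsScalarTower ℝ A A] [SMulCommClass ℝ A A] : LieAlgebra ℝ (Aff A) where
  lie_smul t x y := by ext <;> simp [mul_smul_comm, smul_mul_assoc, smul_sub]

end Aff

/-- The vector space `V` regarded as an abelian Lie algebra. -/
def AbelianLie (V : Type*) : Type _ := V

namespace AbelianLie

variable {V : Type*} [AddCommGroup V]

instance : AddCommGroup (AbelianLie V) := inferInstanceAs (AddCommGroup V)

instance : LieRing (AbelianLie V) where
  bracket _ _ := 0
  add_lie _ _ _ := (add_zero 0).symm
  lie_add _ _ _ := (add_zero 0).symm
  lie_self _ := rfl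
  leibniz_lie _ _ _ := (add_zero 0).symm

variable [Module ℝ V]

instance : Module ℝ (AbelianLie V) := inferInstanceAs (Module ℝ V)

instance : LieAlgebra ℝ (AbelianLie V) where
  lie_smul t _ _ := (smul_zero t).symm

end AbelianLie

/-- The vector space `V` regarded as an associative algebra with the trivial product `a b = 0`. -/
def TrivialAlgebra (V : Type*) : Type _ := V

namespace TrivialAlgebra

variable {V : Type*} [AddCommGroup V]

instance : AddCommGroup (TrivialAlgebra V) := inferInstanceAs (AddCommGroup V)

instance : NonUnitalCommRing (TrivialAlgebra V) where
  mul _ _ := 0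
  left_distrib _ _ _ := (add_zero 0).symm
  right_distrib _ _ _ := (add_zero 0).symm
  zero_mul _ := rfl
  mul_zero _ := rfl
  mul_assoc _ _ _ := rfl
  mul_comm _ _ := rfl

variable [Module ℝ V]

instance : Module ℝ (TrivialAlgebra V) := inferInstanceAs (Module ℝ V)

instance : IsScalarTower ℝ (TrivialAlgebra V) (TrivialAlgebra V) where
  smul_assoc t _ _ := (smul_zero t).symm

instance : SMulCommClass ℝ (TrivialAlgebra V) (TrivialAlgebra V) where
  smul_comm t _ _ := smul_zero t

end TrivialAlgebra

/-- The 3-dimensional Heisenberg algebra with basis `e₁, e₂, e₃` and `[e₁, e₂] = e₃`; its elements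
are the triples `(x, y, z)` of coordinates. -/
@[ext] structure Heisenberg where
  x : ℝ
  y : ℝ
  z : ℝ

namespace Heisenberg

/-- As a set, the Heisenberg algebra is `ℝ³`. -/
def toProd : Heisenberg ≃ ℝ × ℝ × ℝ where
  toFun u := (u.x, u.y, u.z)
  invFun u := ⟨u.1, u.2.1, u.2.2⟩
  left_inv _ := rfl
  right_inv _ := rfl

noncomputable instance : AddCommGroup Heisenberg := toProd.addCommGroup

noncomputable instance : Module ℝ Heisenberg := toProd.module ℝ

noncomputable instance : Bracket Heisenberg Heisenberg where
  bracket u v := ⟨0, 0, u.x * v.y - u.y * v.x⟩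

@[simp] theorem zero_x : (0 : Heisenberg).x = 0 := rfl
@[simp] theorem zero_y : (0 : Heisenberg).y = 0 := rfl
@[simp] theorem zero_z : (0 : Heisenberg).z = 0 := rfl
@[simp] theorem add_x (u v : Heisenberg) : (u + v).x = u.x + v.x := rfl
@[simp] theorem add_y (u v : Heisenberg) : (u + v).y = u.y + v.y := rfl
@[simp] theorem add_z (u v : Heisenberg) : (u + v).z = u.z + v.z := rfl
@[simp] theorem smul_x (t : ℝ) (u : Heisenberg) : (t • u).x = t * u.x := rfl
@[simp] theorem smul_y (t : ℝ) (u : Heisenberg) : (t • u).y = t * u.y := rfl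
@[simp] theorem smul_z (t : ℝ) (u : Heisenberg) : (t • u).z = t * u.z := rfl
@[simp] theorem lie_x (u v : Heisenberg) : ⁅u, v⁆.x = 0 := rfl
@[simp] theorem lie_y (u v : Heisenberg) : ⁅u, v⁆.y = 0 := rfl
@[simp] theorem lie_z (u v : Heisenberg) : ⁅u, v⁆.z = u.x * v.y - u.y * v.x := rfl

noncomputable instance : LieRing Heisenberg where
  add_lie u v w := by ext <;> simp; ring
  lie_add u v w := by ext <;> simp; ring
  lie_self u := by ext <;> simp; ring
  leibniz_lie u v w := by ext <;> simp

noncomputable instance : LieAlgebra ℝ Heisenberg where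
  lie_smul t u v := by ext <;> simp; ring

end Heisenberg

/-- The adjoint action of a Lie algebra `L` on its underlying vector space, the latter regarded as
an abelian Lie algebra: `x` acts by the derivation `v ↦ [x, v]`. -/
def adOnAbelian (L : Type*) [LieRing L] [LieAlgebra ℝ L] :
    L →ₗ⁅ℝ⁆ LieDerivation ℝ (AbelianLie L) (AbelianLie L) where
  toFun x :=
    { toLinearMap := (LieAlgebra.ad ℝ L x : L →ₗ[ℝ] L)
      leibniz' := fun _ _ => (LieAlgebra.ad ℝ L x).map_zero.trans (sub_zero (0 : L)).symm }
  map_add' x y := LieDerivation.ext fun v => add_lie x y (show L from v)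
  map_smul' t x := LieDerivation.ext fun v => smul_lie t x (show L from v)
  map_lie' {x y} := LieDerivation.ext fun v => by
    rw [LieDerivation.lie_apply]
    exact lie_lie x y (show L from v)

theorem adOnAbelian_apply (L : Type*) [LieRing L] [LieAlgebra ℝ L] (x v : L) :
    (adOnAbelian L x (show AbelianLie L from v) : L) = ⁅x, v⁆ := rfl

/-- `ℝ⁴`. -/
abbrev S₀ : Type := AbelianLie (Fin 4 → ℝ)

/-- `𝔥₁ ⊕ ℝ`, a direct sum of ideals. -/
abbrev S₁ : Type := Heisenberg × AbelianLie ℝ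

/-- `aff(ℝ) ⊕ ℝ²`, a direct sum of ideals. -/
abbrev S₂ : Type := Aff ℝ × AbelianLie (Fin 2 → ℝ)

/-- `aff(ℝ) ⊕ aff(ℝ)`, a direct sum of ideals. -/
abbrev S₈ : Type := Aff ℝ × Aff ℝ

/-- `aff(ℝ) ⋉ ℝ²`, where `aff(ℝ)` acts on `ℝ²`, the vector space underlying `aff(ℝ)`,
by the adjoint representation. -/
abbrev S₉ : Type := LieAlgebra.SemiDirectSum (AbelianLie (Aff ℝ)) (Aff ℝ) (adOnAbelian (Aff ℝ))

/-- `aff(ℝ) ⋉ aff(ℝ)`, where `aff(ℝ)` acts on the Lie algebra `aff(ℝ)` by the adjoint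
representation. -/
abbrev S₁₀ : Type := LieAlgebra.SemiDirectSum (Aff ℝ) (Aff ℝ) (LieDerivation.ad ℝ (Aff ℝ))

/-- `aff(ℂ)` as a real Lie algebra. -/
abbrev S₁₁ : Type := Aff ℂ

/-- The algebra of real matrices `(a 0; 0 b)`. -/
def A₈ : Subalgebra ℝ (Matrix (Fin 2) (Fin 2) ℝ) where
  carrier := {M | ∃ a b : ℝ, M = !![a, 0; 0, b]}
  mul_mem' := by
    rintro _ _ ⟨a, b, rfl⟩ ⟨c, d, rfl⟩
    exact ⟨a * c, b * d, by simp⟩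
  add_mem' := by
    rintro _ _ ⟨a, b, rfl⟩ ⟨c, d, rfl⟩
    exact ⟨a + c, b + d, by simp⟩
  algebraMap_mem' r := ⟨r, r, by
    ext i j; fin_cases i <;> fin_cases j <;> simp [Matrix.algebraMap_matrix_apply]⟩

/-- The algebra of real matrices `(a 0; b a)`. -/
def A₉ : Subalgebra ℝ (Matrix (Fin 2) (Fin 2) ℝ) where
  carrier := {M | ∃ a b : ℝ, M = !![a, 0; b, a]}
  mul_mem' := by
    rintro _ _ ⟨a, b, rfl⟩ ⟨c, d, rfl⟩
    exact ⟨a * c, b * c + a * d, by simp⟩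
  add_mem' := by
    rintro _ _ ⟨a, b, rfl⟩ ⟨c, d, rfl⟩
    exact ⟨a + c, b + d, by simp⟩
  algebraMap_mem' r := ⟨r, 0, by
    ext i j; fin_cases i <;> fin_cases j <;> simp [Matrix.algebraMap_matrix_apply]⟩

/-- The algebra of real matrices `(a b; b a)`. -/
def A₁₀ : Subalgebra ℝ (Matrix (Fin 2) (Fin 2) ℝ) where
  carrier := {M | ∃ a b : ℝ, M = !![a, b; b, a]}
  mul_mem' := by
    rintro _ _ ⟨a, b, rfl⟩ ⟨c, d, rfl⟩
    exact ⟨a * c + b * d, a * d + b * c, by simp [add_comm]⟩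
  add_mem' := by
    rintro _ _ ⟨a, b, rfl⟩ ⟨c, d, rfl⟩
    exact ⟨a + c, b + d, by simp⟩
  algebraMap_mem' r := ⟨r, 0, by
    ext i j; fin_cases i <;> fin_cases j <;> simp [Matrix.algebraMap_matrix_apply]⟩

/-- The quotient of the real Lie algebra `s` by its center is isomorphic to `aff(A)`. -/
def ModCenterIsAff (s : Type*) [LieRing s] [LieAlgebra ℝ s] (A : Type*) [NonUnitalRing A]
    [Module ℝ A] [IsScalarTower ℝ A A] [SMulCommClass ℝ A A] : Prop :=
  Nonempty ((s ⧸ LieAlgebra.center ℝ s) ≃ₗ⁅ℝ⁆ Aff A)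

/-! ### Transport along isomorphisms and quotients by the center. -/

section General

variable {s t A : Type*} [LieRing s] [LieAlgebra ℝ s] [LieRing t] [LieAlgebra ℝ t]
  [NonUnitalRing A] [Module ℝ A] [IsScalarTower ℝ A A] [SMulCommClass ℝ A A]

/-! An abelian `J` makes the two eigenspaces of `J` in the complexification abelian subalgebras; a
Lie ring that is the sum of two commutative subsets is metabelian (`lie_lie_lie_eq_zero_of_add`), so
the derived algebra `D` of `s` is abelian.

Let `s` be 4-dimensional and not abelian. The center is `J`-stable. If it is nonzero, it contains
some `v` and `J v`; then `D` is a line, and `s` is `S₁` or `S₂` according to whether that line is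
central.

If the center is zero and `D` meets `J D`, then `D` is a single complex line on which `s` acts
complex linearly, whence `aff(ℂ)`. If the center is zero and `D ∩ J D = 0`, then `D` is a plane, `s
= D ⊕ J D`, and `a · b = [J a, b]` is a commutative associative product on `D` without annihilator.
By `exists_basis_of_commutative_algebra` it is `ℝ × ℝ`, `ℝ[ε]` or `ℂ`, giving `S₈`, `S₉`, `S₁₁`.

Conversely `aff(A)` carries `J(a, b) = (-b, a)` for commutative `A`, and `S₈`, `S₉`, `S₁₀`, `S₁₁`
are `aff` of unital algebras, hence have trivial center; this also settles their quotients. `S₁₀` is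
isomorphic to `S₈`. -/

theorem AdmitsAbelianComplexStructure.of_lieEquiv (h : AdmitsAbelianComplexStructure t)
    (e : s ≃ₗ⁅ℝ⁆ t) : AdmitsAbelianComplexStructure s := by
  obtain ⟨J, hJ⟩ := h
  refine ⟨(e.symm : t →ₗ[ℝ] s) ∘ₗ J ∘ₗ (e : s →ₗ[ℝ] t), ⟨fun x => ?_, fun x y => ?_⟩⟩
  · simp [hJ.sq]
  · apply e.injective
    simp [hJ.lie]

theorem AdmitsAbelianComplexStructure.prod (hs : AdmitsAbelianComplexStructure s)
    (ht : AdmitsAbelianComplexStructure t) : AdmitsAbelianComplexStructure (s × t) := by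
  obtain ⟨J, hJ⟩ := hs
  obtain ⟨K, hK⟩ := ht
  exact ⟨J.prodMap K, ⟨fun x => by simp [hJ.sq, hK.sq, Prod.ext_iff],
    fun x y => by simp [hJ.lie, hK.lie]⟩⟩

/-- A surjective homomorphism onto `aff(A)` whose kernel is the center. -/
theorem ModCenterIsAff.of_surjective (f : s →ₗ⁅ℝ⁆ Aff A) (hf : Function.Surjective f)
    (hker : ∀ x, f x = 0 ↔ ∀ y : s, ⁅y, x⁆ = 0) : ModCenterIsAff s A := by
  have hk : f.ker = LieAlgebra.center ℝ s := by
    ext x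
    simp [LieModule.mem_maxTrivSubmodule, hker]
  have hr : f.range = ⊤ := (LieHom.range_eq_top f).2 hf
  unfold ModCenterIsAff
  rw [← hk]
  exact ⟨f.quotKerEquivRange.trans
    ((LieEquiv.ofEq _ _ (by rw [hr])).trans LieSubalgebra.topEquiv)⟩

theorem ModCenterIsAff.of_lieEquiv (h : ModCenterIsAff t A) (e : s ≃ₗ⁅ℝ⁆ t) :
    ModCenterIsAff s A := by
  obtain ⟨q⟩ := h
  let π : t →ₗ⁅ℝ⁆ t ⧸ LieAlgebra.center ℝ t :=
    { (LieSubmodule.Quotient.mk' (LieAlgebra.center ℝ t) : t →ₗ[ℝ] _) with map_lie' := rfl }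
  have hπ : ∀ x, π x = 0 ↔ ∀ y : t, ⁅y, x⁆ = 0 := fun x =>
    (LieSubmodule.Quotient.mk_eq_zero (N := LieAlgebra.center ℝ t)).trans
      (LieModule.mem_maxTrivSubmodule ℝ t t x)
  refine .of_surjective ((q : _ →ₗ⁅ℝ⁆ Aff A).comp (π.comp (e : s →ₗ⁅ℝ⁆ t))) ?_ fun x => ?_
  · exact q.surjective.comp ((LieSubmodule.Quotient.surjective_mk' _).comp e.surjective)
  · have h1 : q (π (e x)) = 0 ↔ π (e x) = 0 := map_eq_zero_iff q q.injective
    refine (h1.trans (hπ (e x))).trans ⟨fun h y => e.injective ?_, fun h y => ?_⟩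
    · simpa using h (e y)
    · obtain ⟨y, rfl⟩ := e.surjective y
      exact (e.map_lie y x).symm.trans (by rw [h, map_zero])

end General

theorem admitsAbelianComplexStructure_abelianLie (V : Type*) [AddCommGroup V] [Module ℝ V] :
    AdmitsAbelianComplexStructure (AbelianLie (V × V)) :=
  ⟨(LinearMap.prod (-LinearMap.snd ℝ V V) (LinearMap.fst ℝ V V) : V × V →ₗ[ℝ] V × V),
    ⟨fun _ => rfl, fun _ _ => rfl⟩⟩

namespace AbelianLie

/-- Linearly equivalent vector spaces are isomorphic as abelian Lie algebras. -/
def congr {V W : Type*} [AddCommGroup V] [Module ℝ V] [AddCommGroup W] [Module ℝ W]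
    (e : V ≃ₗ[ℝ] W) : AbelianLie V ≃ₗ⁅ℝ⁆ AbelianLie W :=
  { e with map_lie' := e.map_zero }

@[simp] theorem lie_eq_zero {V : Type*} [AddCommGroup V] (x y : AbelianLie V) : ⁅x, y⁆ = 0 := rfl

end AbelianLie

/-! ### The Lie algebras `aff(A)`. -/

namespace Aff

variable {A : Type*}

section Linear

variable [NonUnitalRing A] [Module ℝ A]

/-- `aff(A)` is `A × A` as a vector space. -/
def linearEquivProd : Aff A ≃ₗ[ℝ] A × A :=
  { toProd with
    map_add' := fun _ _ => rfl
    map_smul' := fun _ _ => rfl }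

end Linear

theorem admitsAbelianComplexStructure [NonUnitalCommRing A] [Module ℝ A] [IsScalarTower ℝ A A]
    [SMulCommClass ℝ A A] : AdmitsAbelianComplexStructure (Aff A) := by
  refine ⟨{ toFun := fun x => ⟨-x.snd, x.fst⟩, map_add' := fun x y => ?_,
            map_smul' := fun r x => ?_ }, ⟨fun x => ?_, fun x y => ?_⟩⟩
  · ext
    · simp [add_comm]
    · simp
  · ext <;> simp
  · rfl
  · ext
    · simp [mul_comm]
    · simp [mul_comm, sub_eq_add_neg, add_comm]

/-- With a unit, bracketing with `(1, 0)` and `(0, 1)` recovers the second component and, up to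
sign, the first. -/
theorem eq_zero_of_forall_lie_eq_zero [Ring A] [Module ℝ A] [IsScalarTower ℝ A A]
    [SMulCommClass ℝ A A] {x : Aff A} (h : ∀ y : Aff A, ⁅y, x⁆ = 0) : x = 0 := by
  have h1 := congrArg snd (h ⟨1, 0⟩)
  have h2 := congrArg snd (h ⟨0, 1⟩)
  ext
  · simpa using h2
  · simpa using h1

end Aff

theorem ModCenterIsAff.of_lieEquiv_aff {s A : Type*} [LieRing s] [LieAlgebra ℝ s] [Ring A]
    [Module ℝ A] [IsScalarTower ℝ A A] [SMulCommClass ℝ A A] (e : s ≃ₗ⁅ℝ⁆ Aff A) :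
    ModCenterIsAff s A := by
  refine .of_surjective (e : s →ₗ⁅ℝ⁆ Aff A) e.surjective fun x =>
    ⟨fun h y => ?_, fun h => ?_⟩
  · have : x = 0 := e.injective (by simpa using h)
    rw [this, lie_zero]
  · refine Aff.eq_zero_of_forall_lie_eq_zero fun y => ?_
    obtain ⟨y, rfl⟩ := e.surjective y
    exact (e.map_lie y x).symm.trans (by rw [h, map_zero])

/-- An isomorphism of algebras induces an isomorphism of the Lie algebras `aff`. -/
def Aff.congr {A B : Type*} [NonUnitalRing A] [Module ℝ A] [IsScalarTower ℝ A A]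
    [SMulCommClass ℝ A A] [NonUnitalRing B] [Module ℝ B] [IsScalarTower ℝ B B]
    [SMulCommClass ℝ B B] (e : A ≃ₗ[ℝ] B) (he : ∀ x y, e (x * y) = e x * e y) :
    Aff A ≃ₗ⁅ℝ⁆ Aff B where
  toFun x := ⟨e x.fst, e x.snd⟩
  invFun x := ⟨e.symm x.fst, e.symm x.snd⟩
  left_inv x := by simp
  right_inv x := by simp
  map_add' x y := by ext <;> simp
  map_smul' r x := by ext <;> simp
  map_lie' {x y} := by ext <;> simp [he]

/-- `aff` of a product is the direct sum of ideals. -/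
def Aff.prodEquiv (A B : Type*) [NonUnitalRing A] [Module ℝ A] [IsScalarTower ℝ A A]
    [SMulCommClass ℝ A A] [NonUnitalRing B] [Module ℝ B] [IsScalarTower ℝ B B]
    [SMulCommClass ℝ B B] : (Aff A × Aff B) ≃ₗ⁅ℝ⁆ Aff (A × B) where
  toFun x := ⟨(x.1.fst, x.2.fst), (x.1.snd, x.2.snd)⟩
  invFun x := (⟨x.fst.1, x.snd.1⟩, ⟨x.fst.2, x.snd.2⟩)
  left_inv _ := rfl
  right_inv _ := rfl
  map_add' _ _ := rfl
  map_smul' _ _ := rfl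
  map_lie' := rfl

/-- The semidirect sum of a Lie algebra with itself by the adjoint action is the direct sum. -/
def semiDirectSumAdEquiv (L : Type*) [LieRing L] [LieAlgebra ℝ L] :
    LieAlgebra.SemiDirectSum L L (LieDerivation.ad ℝ L) ≃ₗ⁅ℝ⁆ L × L where
  -- The ideal goes to the second factor and the acting copy to the diagonal, whose elements act on
  -- that factor by `ad`.
  toFun x := (x.right, x.left + x.right)
  invFun x := ⟨x.2 - x.1, x.1⟩
  left_inv x := by simp
  right_inv x := by simp
  map_add' x y := by simp; abel
  map_smul' r x := by simp
  map_lie' {x y} := by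
    simp only [LieAlgebra.SemiDirectSum.lie_eq_mk, LieDerivation.ad_apply_apply,
      LieAlgebra.Prod.bracket_apply, lie_add, add_lie, Prod.mk.injEq, true_and]
    rw [← lie_skew x.left y.right]
    abel

/-! ### The models as `aff` of matrix algebras. -/

/-- Diagonal matrices form the algebra `ℝ × ℝ`. -/
noncomputable def prodEquivA₈ : (ℝ × ℝ) ≃ₗ[ℝ] A₈ where
  toFun x := ⟨!![x.1, 0; 0, x.2], x.1, x.2, rfl⟩
  invFun M := (M.1 0 0, M.1 1 1)
  left_inv x := by simp
  right_inv := by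
    rintro ⟨_, a, b, rfl⟩
    simp
  map_add' x y := by ext i j; fin_cases i <;> fin_cases j <;> simp
  map_smul' r x := by ext i j; fin_cases i <;> fin_cases j <;> simp

theorem prodEquivA₈_mul (x y : ℝ × ℝ) : prodEquivA₈ (x * y) = prodEquivA₈ x * prodEquivA₈ y := by
  ext i j; fin_cases i <;> fin_cases j <;> simp [prodEquivA₈]

/-- The matrices `(a b; b a)` form the algebra `ℝ × ℝ`. -/
noncomputable def prodEquivA₁₀ : (ℝ × ℝ) ≃ₗ[ℝ] A₁₀ where
  -- The coordinates are the eigenvalues `a + b` and `a - b`.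
  toFun x := ⟨!![(x.1 + x.2) / 2, (x.1 - x.2) / 2; (x.1 - x.2) / 2, (x.1 + x.2) / 2],
    _, _, rfl⟩
  invFun M := (M.1 0 0 + M.1 0 1, M.1 0 0 - M.1 0 1)
  left_inv x := by ext <;> simp <;> ring
  right_inv := by
    rintro ⟨_, a, b, rfl⟩
    ext i j; fin_cases i <;> fin_cases j <;> simp
  map_add' x y := by ext i j; fin_cases i <;> fin_cases j <;> simp <;> ring
  map_smul' r x := by ext i j; fin_cases i <;> fin_cases j <;> simp <;> ring

theorem prodEquivA₁₀_mul (x y : ℝ × ℝ) :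
    prodEquivA₁₀ (x * y) = prodEquivA₁₀ x * prodEquivA₁₀ y := by
  ext i j; fin_cases i <;> fin_cases j <;> simp [prodEquivA₁₀] <;> ring

theorem A₈_mul_comm (a b : A₈) : a * b = b * a := by
  obtain ⟨x, rfl⟩ := prodEquivA₈.surjective a
  obtain ⟨y, rfl⟩ := prodEquivA₈.surjective b
  rw [← prodEquivA₈_mul, ← prodEquivA₈_mul, mul_comm]

theorem A₁₀_mul_comm (a b : A₁₀) : a * b = b * a := by
  obtain ⟨x, rfl⟩ := prodEquivA₁₀.surjective a
  obtain ⟨y, rfl⟩ := prodEquivA₁₀.surjective b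
  rw [← prodEquivA₁₀_mul, ← prodEquivA₁₀_mul, mul_comm]

theorem A₉_mul_comm (a b : A₉) : a * b = b * a := by
  rcases a with ⟨_, p, q, rfl⟩
  rcases b with ⟨_, r, t, rfl⟩
  ext i j; fin_cases i <;> fin_cases j <;> simp <;> ring

/-- The component of an element of `S₉` in the abelian ideal, as an element of `aff(ℝ)`. -/
def S₉.toAff (x : S₉) : Aff ℝ := x.left

theorem S₉.toAff_add (x y : S₉) : S₉.toAff (x + y) = S₉.toAff x + S₉.toAff y := rfl

theorem S₉.toAff_smul (r : ℝ) (x : S₉) : S₉.toAff (r • x) = r • S₉.toAff x := rfl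

theorem S₉.toAff_lie (x y : S₉) :
    S₉.toAff ⁅x, y⁆ = ⁅x.right, S₉.toAff y⁆ - ⁅y.right, S₉.toAff x⁆ :=
  -- The summand `0` is the bracket inside the abelian ideal.
  congrArg (· - ⁅y.right, S₉.toAff x⁆) (zero_add ⁅x.right, S₉.toAff y⁆)

theorem S₉.right_add (x y : S₉) : (x + y).right = x.right + y.right := rfl

theorem S₉.right_smul (r : ℝ) (x : S₉) : (r • x).right = r • x.right := rfl

theorem S₉.right_lie (x y : S₉) : ⁅x, y⁆.right = ⁅x.right, y.right⁆ := rfl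

theorem Aff.sub_fst {A : Type*} [NonUnitalRing A] (x y : Aff A) :
    (x - y).fst = x.fst - y.fst := rfl

theorem Aff.sub_snd {A : Type*} [NonUnitalRing A] (x y : Aff A) :
    (x - y).snd = x.snd - y.snd := rfl

/-- `aff(ℝ[ε]) = aff(ℝ) ⊕ ε aff(ℝ)`. -/
noncomputable def S₉EquivAff : S₉ ≃ₗ⁅ℝ⁆ Aff A₉ where
  toFun x := ⟨⟨!![x.right.fst, 0; (S₉.toAff x).fst, x.right.fst], _, _, rfl⟩,
    ⟨!![x.right.snd, 0; (S₉.toAff x).snd, x.right.snd], _, _, rfl⟩⟩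
  invFun M := ⟨(⟨M.fst.1 1 0, M.snd.1 1 0⟩ : Aff ℝ), ⟨M.fst.1 0 0, M.snd.1 0 0⟩⟩
  left_inv _ := rfl
  right_inv := by
    rintro ⟨⟨_, a, b, rfl⟩, ⟨_, c, d, rfl⟩⟩
    ext i j <;> fin_cases i <;> fin_cases j <;> simp [S₉.toAff]
  map_add' x y := by
    simp only [S₉.toAff_add, S₉.right_add]
    ext i j <;> fin_cases i <;> fin_cases j <;> simp
  map_smul' r x := by
    simp only [S₉.toAff_smul, S₉.right_smul]
    ext i j <;> fin_cases i <;> fin_cases j <;> simp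
  map_lie' {x y} := by
    simp only [S₉.toAff_lie, S₉.right_lie]
    ext i j <;> fin_cases i <;> fin_cases j <;> simp [Aff.sub_fst, Aff.sub_snd] <;> ring

/-- `aff(ℝ) ⊕ aff(ℝ)` is `aff` of the diagonal matrices. -/
noncomputable def S₈EquivAff : S₈ ≃ₗ⁅ℝ⁆ Aff A₈ :=
  (Aff.prodEquiv ℝ ℝ).trans (Aff.congr prodEquivA₈ prodEquivA₈_mul)

/-- `aff(ℝ) ⋉ aff(ℝ)` is `aff` of the matrices `(a b; b a)`. -/
noncomputable def S₁₀EquivAff : S₁₀ ≃ₗ⁅ℝ⁆ Aff A₁₀ :=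
  ((semiDirectSumAdEquiv (Aff ℝ)).trans (Aff.prodEquiv ℝ ℝ)).trans
    (Aff.congr prodEquivA₁₀ prodEquivA₁₀_mul)

/-! ### Quotients by a nontrivial center. -/

theorem modCenterIsAff_S₀ : ModCenterIsAff S₀ (TrivialAlgebra PUnit.{1}) := by
  refine .of_surjective (0 : S₀ →ₗ⁅ℝ⁆ Aff (TrivialAlgebra PUnit.{1}))
    (fun x => ⟨0, rfl⟩) fun x => ⟨fun _ _ => rfl, fun _ => rfl⟩

theorem modCenterIsAff_S₁ : ModCenterIsAff S₁ (TrivialAlgebra ℝ) := by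
  let f : S₁ →ₗ⁅ℝ⁆ Aff (TrivialAlgebra ℝ) :=
    { toFun := fun x => ⟨x.1.x, x.1.y⟩
      map_add' := fun _ _ => rfl
      map_smul' := fun _ _ => rfl
      map_lie' := fun {x y} => Aff.ext (sub_zero (0 : ℝ)).symm (sub_zero (0 : ℝ)).symm }
  refine .of_surjective f (fun x => ⟨(⟨x.fst, x.snd, 0⟩, 0), rfl⟩)
    fun x => ⟨fun h y => ?_, fun h => ?_⟩
  · have h1 : x.1.x = 0 := congrArg Aff.fst h
    have h2 : x.1.y = 0 := congrArg Aff.snd h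
    ext <;> simp [h1, h2]
  · have h1 := congrArg (fun z : S₁ => z.1.z) (h (⟨1, 0, 0⟩, 0))
    have h2 := congrArg (fun z : S₁ => z.1.z) (h (⟨0, 1, 0⟩, 0))
    simp at h1 h2
    exact Aff.ext h2 h1

theorem modCenterIsAff_S₂ : ModCenterIsAff S₂ ℝ := by
  refine .of_surjective (LieHom.fst ℝ (Aff ℝ) (AbelianLie (Fin 2 → ℝ)))
    (LieHom.fst_surjective) fun x => ⟨fun h y => ?_, fun h => ?_⟩
  · simp at h
    simp [h]
  · refine Aff.eq_zero_of_forall_lie_eq_zero fun y => ?_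
    exact congrArg Prod.fst (h (y, 0))

/-! ### Dimensions of the models. -/

theorem finrank_aff (A : Type*) [NonUnitalRing A] [Module ℝ A] [FiniteDimensional ℝ A] :
    Module.finrank ℝ (Aff A) = Module.finrank ℝ A + Module.finrank ℝ A := by
  rw [Aff.linearEquivProd.finrank_eq, Module.finrank_prod]

instance Aff.finiteDimensional (A : Type*) [NonUnitalRing A] [Module ℝ A]
    [FiniteDimensional ℝ A] : FiniteDimensional ℝ (Aff A) :=
  Aff.linearEquivProd.symm.finiteDimensional

/-- The Heisenberg algebra is `ℝ³` as a vector space. -/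
noncomputable def Heisenberg.linearEquivProd : Heisenberg ≃ₗ[ℝ] ℝ × ℝ × ℝ :=
  { Heisenberg.toProd with
    map_add' := fun _ _ => rfl
    map_smul' := fun _ _ => rfl }

instance Heisenberg.finiteDimensional : FiniteDimensional ℝ Heisenberg :=
  Heisenberg.linearEquivProd.symm.finiteDimensional

instance AbelianLie.finiteDimensional (V : Type*) [AddCommGroup V] [Module ℝ V]
    [FiniteDimensional ℝ V] : FiniteDimensional ℝ (AbelianLie V) :=
  inferInstanceAs (FiniteDimensional ℝ V)

theorem AbelianLie.finrank_eq (V : Type*) [AddCommGroup V] [Module ℝ V] :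
    Module.finrank ℝ (AbelianLie V) = Module.finrank ℝ V := rfl

theorem finrank_S₀ : Module.finrank ℝ S₀ = 4 := by
  rw [AbelianLie.finrank_eq]; simp

theorem finrank_S₁ : Module.finrank ℝ S₁ = 4 := by
  rw [Module.finrank_prod, Heisenberg.linearEquivProd.finrank_eq, AbelianLie.finrank_eq]; simp

theorem finrank_S₂ : Module.finrank ℝ S₂ = 4 := by
  rw [Module.finrank_prod, finrank_aff, AbelianLie.finrank_eq]; simp

theorem finrank_S₈ : Module.finrank ℝ S₈ = 4 := by
  rw [Module.finrank_prod, finrank_aff]; simp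

theorem finrank_S₉ : Module.finrank ℝ S₉ = 4 := by
  rw [(LieAlgebra.SemiDirectSum.toProdl (adOnAbelian (Aff ℝ))).finrank_eq, Module.finrank_prod,
    AbelianLie.finrank_eq, finrank_aff]; simp

theorem finrank_S₁₀ : Module.finrank ℝ S₁₀ = 4 := by
  rw [(semiDirectSumAdEquiv (Aff ℝ)).toLinearEquiv.finrank_eq, finrank_S₈]

theorem finrank_S₁₁ : Module.finrank ℝ S₁₁ = 4 := by
  rw [finrank_aff]; simp

/-! ### Abelian complex structures on the models. -/

theorem admits_S₀ : AdmitsAbelianComplexStructure S₀ :=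
  (admitsAbelianComplexStructure_abelianLie (ℝ × ℝ)).of_lieEquiv
    (AbelianLie.congr (LinearEquiv.ofFinrankEq _ _ (by simp)))

theorem admits_S₁ : AdmitsAbelianComplexStructure S₁ := by
  -- `J` sends `e₁` to `e₂`, and `e₃` to the generator of the summand `ℝ`.
  refine ⟨{ toFun := fun p => (⟨-p.1.y, p.1.x, -(show ℝ from p.2)⟩, p.1.z),
            map_add' := fun p q => ?_, map_smul' := fun r p => ?_ },
    ⟨fun p => rfl, fun p q => ?_⟩⟩
  · refine Prod.ext (Heisenberg.ext ?_ rfl ?_) rfl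
    · exact neg_add _ _
    · exact neg_add (show ℝ from p.2) (show ℝ from q.2)
  · refine Prod.ext (Heisenberg.ext ?_ rfl ?_) rfl
    · exact (mul_neg _ _).symm
    · exact (mul_neg r (show ℝ from p.2)).symm
  · refine Prod.ext (Heisenberg.ext rfl rfl ?_) rfl
    simp only [LinearMap.coe_mk, AddHom.coe_mk, LieAlgebra.Prod.bracket_apply, Heisenberg.lie_z]
    ring

theorem admits_S₂ : AdmitsAbelianComplexStructure S₂ :=
  Aff.admitsAbelianComplexStructure.prod
    ((admitsAbelianComplexStructure_abelianLie ℝ).of_lieEquiv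
      (AbelianLie.congr (LinearEquiv.ofFinrankEq _ _ (by simp))))

theorem admits_S₈ : AdmitsAbelianComplexStructure S₈ :=
  Aff.admitsAbelianComplexStructure.prod Aff.admitsAbelianComplexStructure

theorem admits_S₁₀ : AdmitsAbelianComplexStructure S₁₀ :=
  admits_S₈.of_lieEquiv (semiDirectSumAdEquiv (Aff ℝ))

theorem admits_S₁₁ : AdmitsAbelianComplexStructure S₁₁ :=
  Aff.admitsAbelianComplexStructure

/-- A commutative subalgebra as a nonunital commutative ring. -/
abbrev Subalgebra.nonUnitalCommRing {B : Type*} [Ring B] [Algebra ℝ B] (A : Subalgebra ℝ B)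
    (h : ∀ a b : A, a * b = b * a) : NonUnitalCommRing A where
  mul_comm := h

theorem admits_S₉ : AdmitsAbelianComplexStructure S₉ := by
  let := A₉.nonUnitalCommRing A₉_mul_comm
  exact (Aff.admitsAbelianComplexStructure (A := A₉)).of_lieEquiv S₉EquivAff

/-! ### Metabelianity. -/

/-- If a Lie ring is the sum of two commutative subsets, then brackets between the two subsets
commute. -/
theorem lie_lie_lie_eq_zero_of_commute {L : Type*} [LieRing L] {A B : Set L}
    (hA : ∀ x ∈ A, ∀ y ∈ A, ⁅x, y⁆ = 0) (hB : ∀ x ∈ B, ∀ y ∈ B, ⁅x, y⁆ = 0)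
    (hAB : ∀ z : L, ∃ a ∈ A, ∃ b ∈ B, z = a + b) {x x' y y' : L} (hx : x ∈ A) (hx' : x' ∈ A)
    (hy : y ∈ B) (hy' : y' ∈ B) : ⁅⁅x, y⁆, ⁅x', y'⁆⁆ = 0 := by
  -- Only the parts `b₂` and `a₃` of these brackets survive; expanding by Jacobi gives `⁅a₃, b₂⁆`
  -- twice, with opposite signs.
  obtain ⟨a₂, ha₂, b₂, hb₂, h₂⟩ := hAB ⁅y, x'⁆
  obtain ⟨a₃, ha₃, b₃, hb₃, h₃⟩ := hAB ⁅x, y'⁆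
  have h1 : ⁅⁅x, y⁆, x'⁆ = ⁅x, b₂⁆ := by
    rw [lie_lie, hA x hx x' hx', lie_zero, sub_zero, h₂, lie_add, hA x hx a₂ ha₂, zero_add]
  have h2 : ⁅⁅x, y⁆, y'⁆ = ⁅a₃, y⁆ := by
    rw [lie_lie, hB y hy y' hy', lie_zero, zero_sub, lie_skew, h₃, add_lie, hB b₃ hb₃ y hy,
      add_zero]
  have h3 : ⁅⁅x, b₂⁆, y'⁆ = ⁅a₃, b₂⁆ := by
    rw [lie_lie, hB b₂ hb₂ y' hy', lie_zero, zero_sub, lie_skew, h₃, add_lie,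
      hB b₃ hb₃ b₂ hb₂, add_zero]
  have h4 : ⁅⁅a₃, y⁆, x'⁆ = ⁅a₃, b₂⁆ := by
    rw [lie_lie, hA a₃ ha₃ x' hx', lie_zero, sub_zero, h₂, lie_add, hA a₃ ha₃ a₂ ha₂, zero_add]
  rw [leibniz_lie, h1, h3, h2, ← lie_skew x', h4]
  exact add_neg_cancel _

/-- A Lie ring which is the sum of two commutative subsets is metabelian: the analogue of a theorem
of Itô on groups. -/
theorem lie_lie_lie_eq_zero_of_add {L : Type*} [LieRing L] {A B : Set L}
    (hA : ∀ x ∈ A, ∀ y ∈ A, ⁅x, y⁆ = 0) (hB : ∀ x ∈ B, ∀ y ∈ B, ⁅x, y⁆ = 0)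
    (hAB : ∀ z : L, ∃ a ∈ A, ∃ b ∈ B, z = a + b) (x y z w : L) : ⁅⁅x, y⁆, ⁅z, w⁆⁆ = 0 := by
  have key := @lie_lie_lie_eq_zero_of_commute L _ A B hA hB hAB
  obtain ⟨x₁, hx₁, x₂, hx₂, rfl⟩ := hAB x
  obtain ⟨y₁, hy₁, y₂, hy₂, rfl⟩ := hAB y
  obtain ⟨z₁, hz₁, z₂, hz₂, rfl⟩ := hAB z
  obtain ⟨w₁, hw₁, w₂, hw₂, rfl⟩ := hAB w
  have h1 : ⁅x₁ + x₂, y₁ + y₂⁆ = ⁅x₁, y₂⁆ - ⁅y₁, x₂⁆ := by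
    rw [add_lie, lie_add, lie_add, hA _ hx₁ _ hy₁, hB _ hx₂ _ hy₂, ← lie_skew y₁ x₂]
    abel
  have h2 : ⁅z₁ + z₂, w₁ + w₂⁆ = ⁅z₁, w₂⁆ - ⁅w₁, z₂⁆ := by
    rw [add_lie, lie_add, lie_add, hA _ hz₁ _ hw₁, hB _ hz₂ _ hw₂, ← lie_skew w₁ z₂]
    abel
  rw [h1, h2]
  simp [key hx₁ hz₁ hy₂ hw₂, key hx₁ hw₁ hy₂ hz₂, key hy₁ hz₁ hx₂ hw₂, key hy₁ hw₁ hx₂ hz₂]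

namespace IsAbelianComplexStructure

open TensorProduct

variable {s : Type*} [LieRing s] [LieAlgebra ℝ s] {J : s →ₗ[ℝ] s}

theorem lie_left (hJ : IsAbelianComplexStructure J) (x y : s) : ⁅J x, y⁆ = -⁅x, J y⁆ := by
  have := hJ.lie x (J y)
  rw [hJ.sq, lie_neg] at this
  rw [← this, neg_neg]

/-- A Lie algebra with an abelian complex structure is metabelian. -/
theorem lie_lie_lie_eq_zero (hJ : IsAbelianComplexStructure J) (x y z w : s) :
    ⁅⁅x, y⁆, ⁅z, w⁆⁆ = 0 := by
  have hI : Complex.I * Complex.I = -1 := Complex.I_mul_I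
  -- `A` and `B` are the eigenspaces of `J` for `i` and `-i`.
  have h := lie_lie_lie_eq_zero_of_add (L := ℂ ⊗[ℝ] s)
    (A := Set.range fun x : s => (1 : ℂ) ⊗ₜ[ℝ] x - Complex.I ⊗ₜ[ℝ] J x)
    (B := Set.range fun x : s => (1 : ℂ) ⊗ₜ[ℝ] x + Complex.I ⊗ₜ[ℝ] J x) ?_ ?_ ?_
    ((1 : ℂ) ⊗ₜ[ℝ] x) ((1 : ℂ) ⊗ₜ[ℝ] y) ((1 : ℂ) ⊗ₜ[ℝ] z) ((1 : ℂ) ⊗ₜ[ℝ] w)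
  · simp only [LieAlgebra.ExtendScalars.bracket_tmul, mul_one] at h
    -- Injectivity of `x ↦ 1 ⊗ x` brings the identity back to `s`.
    have hinj := Module.FaithfullyFlat.tensorProduct_mk_injective (A := ℝ) (B := ℂ) s
    exact hinj (h.trans (TensorProduct.tmul_zero _ _).symm)
  · rintro _ ⟨x, rfl⟩ _ ⟨y, rfl⟩
    simp only [sub_lie, lie_sub, LieAlgebra.ExtendScalars.bracket_tmul, hI,
      hJ.lie, one_mul, mul_one, TensorProduct.neg_tmul]
    rw [hJ.lie_left x y, TensorProduct.tmul_neg]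
    abel
  · rintro _ ⟨x, rfl⟩ _ ⟨y, rfl⟩
    simp only [add_lie, lie_add, LieAlgebra.ExtendScalars.bracket_tmul, hI,
      hJ.lie, one_mul, mul_one, TensorProduct.neg_tmul]
    rw [hJ.lie_left x y, TensorProduct.tmul_neg]
    abel
  · intro z
    induction z using TensorProduct.induction_on with
    | zero => exact ⟨0, ⟨0, by simp⟩, 0, ⟨0, by simp⟩, by simp⟩
    | tmul c x =>
      -- These come from the eigenprojections `z ↦ (z ∓ i J z) / 2` applied to `c ⊗ x`.
      refine ⟨_, ⟨(1 / 2 : ℝ) • (c.re • x + c.im • J x), rfl⟩, _,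
        ⟨(1 / 2 : ℝ) • (c.re • x - c.im • J x), rfl⟩, ?_⟩
      have hc : c = c.re • 1 + c.im • Complex.I := by
        simp [Complex.re_add_im]
      conv_lhs => rw [hc]
      simp only [map_smul, map_add, map_sub, hJ.sq, TensorProduct.add_tmul, TensorProduct.tmul_add,
        TensorProduct.tmul_sub, TensorProduct.tmul_smul, TensorProduct.smul_tmul',
        TensorProduct.tmul_neg, smul_neg]
      module
    | add u v hu hv =>
      obtain ⟨_, ⟨a, rfl⟩, _, ⟨b, rfl⟩, rfl⟩ := hu
      obtain ⟨_, ⟨c, rfl⟩, _, ⟨d, rfl⟩, rfl⟩ := hv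
      refine ⟨_, ⟨a + c, rfl⟩, _, ⟨b + d, rfl⟩, ?_⟩
      simp only [map_add, TensorProduct.tmul_add]
      abel

end IsAbelianComplexStructure

/-! ### Bases in dimensions four and two. -/

theorem linearIndependent_four_iff {V : Type*} [AddCommGroup V] [Module ℝ V] {e₁ e₂ e₃ e₄ : V} :
    LinearIndependent ℝ ![e₁, e₂, e₃, e₄] ↔
      ∀ a b c d : ℝ, a • e₁ + b • e₂ + c • e₃ + d • e₄ = 0 → a = 0 ∧ b = 0 ∧ c = 0 ∧ d = 0 := by
  rw [Fintype.linearIndependent_iff]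
  constructor
  · intro h a b c d habcd
    have := h ![a, b, c, d] (by simpa [Fin.sum_univ_four] using habcd)
    exact ⟨this 0, this 1, this 2, this 3⟩
  · intro h g hg i
    obtain ⟨h0, h1, h2, h3⟩ := h (g 0) (g 1) (g 2) (g 3) (by simpa [Fin.sum_univ_four] using hg)
    fin_cases i <;> assumption

theorem LinearIndependent.exists_eq_of_finrank_eq_four {V : Type*} [AddCommGroup V] [Module ℝ V]
    {e₁ e₂ e₃ e₄ : V} (h : LinearIndependent ℝ ![e₁, e₂, e₃, e₄]) (hV : Module.finrank ℝ V = 4)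
    (x : V) : ∃ a b c d : ℝ, x = a • e₁ + b • e₂ + c • e₃ + d • e₄ := by
  have htop := h.span_eq_top_of_card_eq_finrank (by simp [hV])
  have hx : x ∈ Submodule.span ℝ (Set.range ![e₁, e₂, e₃, e₄]) := htop ▸ Submodule.mem_top
  obtain ⟨c, rfl⟩ := (Submodule.mem_span_range_iff_exists_fun ℝ).1 hx
  exact ⟨c 0, c 1, c 2, c 3, by simp [Fin.sum_univ_four]⟩

theorem LinearIndependent.exists_eq_of_finrank_eq_two {V : Type*} [AddCommGroup V] [Module ℝ V]
    {e₁ e₂ : V} (h : LinearIndependent ℝ ![e₁, e₂]) (hV : Module.finrank ℝ V = 2)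
    (x : V) : ∃ a b : ℝ, x = a • e₁ + b • e₂ := by
  have htop := h.span_eq_top_of_card_eq_finrank (by simp [hV])
  have hx : x ∈ Submodule.span ℝ (Set.range ![e₁, e₂]) := htop ▸ Submodule.mem_top
  obtain ⟨c, rfl⟩ := (Submodule.mem_span_range_iff_exists_fun ℝ).1 hx
  exact ⟨c 0, c 1, by simp [Fin.sum_univ_two]⟩

/-! ### Recognizing the models from bracket tables. -/

section Recognition

variable {s : Type*} [LieRing s] [LieAlgebra ℝ s] {e₁ e₂ e₃ e₄ : s}

theorem nonempty_lieEquiv_of_injective {t : Type*} [LieRing t] [LieAlgebra ℝ t]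
    (hs : Module.finrank ℝ s = 4) (ht : Module.finrank ℝ t = 4) (f : t →ₗ⁅ℝ⁆ s)
    (hf : ∀ x, f x = 0 → x = 0) : Nonempty (s ≃ₗ⁅ℝ⁆ t) := by
  have : FiniteDimensional ℝ s := Module.finite_of_finrank_pos (by omega)
  have : FiniteDimensional ℝ t := Module.finite_of_finrank_pos (by omega)
  have hinj : Function.Injective (f : t →ₗ[ℝ] s) := (injective_iff_map_eq_zero _).2 hf
  have hsurj := (LinearMap.injective_iff_surjective_of_finrank_eq_finrank
    (f := (f : t →ₗ[ℝ] s)) (by rw [hs, ht])).1 hinj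
  exact ⟨(LieEquiv.ofBijective f ⟨hinj, hsurj⟩).symm⟩

theorem nonempty_lieEquiv_S₀ (hs : Module.finrank ℝ s = 4) (h : ∀ x y : s, ⁅x, y⁆ = 0) :
    Nonempty (s ≃ₗ⁅ℝ⁆ S₀) := by
  have : FiniteDimensional ℝ s := Module.finite_of_finrank_pos (by omega)
  let e : s ≃ₗ[ℝ] S₀ := LinearEquiv.ofFinrankEq _ _ (by rw [hs, finrank_S₀])
  exact ⟨{ e with map_lie' := fun {x y} => (congrArg e (h x y)).trans (map_zero e) }⟩

theorem nonempty_lieEquiv_S₁ (hs : Module.finrank ℝ s = 4)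
    (hli : LinearIndependent ℝ ![e₁, e₂, e₃, e₄]) (h₁₂ : ⁅e₁, e₂⁆ = e₃)
    (h₃ : ∀ x : s, ⁅e₃, x⁆ = 0) (h₄ : ∀ x : s, ⁅e₄, x⁆ = 0) : Nonempty (s ≃ₗ⁅ℝ⁆ S₁) := by
  have h₃' : ∀ x : s, ⁅x, e₃⁆ = 0 := fun x => by rw [← lie_skew, h₃, neg_zero]
  have h₄' : ∀ x : s, ⁅x, e₄⁆ = 0 := fun x => by rw [← lie_skew, h₄, neg_zero]
  have h₂₁ : ⁅e₂, e₁⁆ = -e₃ := by rw [← lie_skew, h₁₂]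
  let c : S₁ →ₗ[ℝ] ℝ := LinearMap.snd ℝ Heisenberg (AbelianLie ℝ)
  have hc : ∀ x y : S₁, c ⁅x, y⁆ = 0 := fun _ _ => rfl
  refine nonempty_lieEquiv_of_injective hs finrank_S₁
    { toFun := fun p => p.1.x • e₁ + p.1.y • e₂ + p.1.z • e₃ + c p • e₄
      map_add' := fun p q => ?_
      map_smul' := fun r p => ?_
      map_lie' := fun {p q} => ?_ } fun p hp => ?_
  · simp only [Prod.fst_add, Heisenberg.add_x, Heisenberg.add_y, Heisenberg.add_z, map_add]
    module
  · simp only [Prod.smul_fst, Heisenberg.smul_x, Heisenberg.smul_y, Heisenberg.smul_z, map_smul,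
      smul_eq_mul, RingHom.id_apply]
    module
  · simp only [hc]
    simp only [LieAlgebra.Prod.bracket_apply, Heisenberg.lie_x, Heisenberg.lie_y,
      Heisenberg.lie_z, lie_add, add_lie, smul_lie, lie_smul, lie_self, h₁₂, h₂₁, h₃, h₄, h₃', h₄']
    module
  · obtain ⟨h1, h2, h3, h4⟩ := linearIndependent_four_iff.1 hli _ _ _ _ hp
    exact Prod.ext (Heisenberg.ext h1 h2 h3) h4

theorem nonempty_lieEquiv_S₂ (hs : Module.finrank ℝ s = 4)
    (hli : LinearIndependent ℝ ![e₁, e₂, e₃, e₄]) (h₁₂ : ⁅e₁, e₂⁆ = e₂)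
    (h₃ : ∀ x : s, ⁅e₃, x⁆ = 0) (h₄ : ∀ x : s, ⁅e₄, x⁆ = 0) : Nonempty (s ≃ₗ⁅ℝ⁆ S₂) := by
  have h₃' : ∀ x : s, ⁅x, e₃⁆ = 0 := fun x => by rw [← lie_skew, h₃, neg_zero]
  have h₄' : ∀ x : s, ⁅x, e₄⁆ = 0 := fun x => by rw [← lie_skew, h₄, neg_zero]
  have h₂₁ : ⁅e₂, e₁⁆ = -e₂ := by rw [← lie_skew, h₁₂]
  let c : S₂ →ₗ[ℝ] Fin 2 → ℝ := LinearMap.snd ℝ (Aff ℝ) (AbelianLie (Fin 2 → ℝ))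
  have hc : ∀ x y : S₂, c ⁅x, y⁆ = 0 := fun _ _ => rfl
  refine nonempty_lieEquiv_of_injective hs finrank_S₂
    { toFun := fun p => p.1.fst • e₁ + p.1.snd • e₂ + c p 0 • e₃ + c p 1 • e₄
      map_add' := fun p q => ?_
      map_smul' := fun r p => ?_
      map_lie' := fun {p q} => ?_ } fun p hp => ?_
  · simp only [Prod.fst_add, Aff.add_fst, Aff.add_snd, map_add, Pi.add_apply]
    module
  · simp only [Prod.smul_fst, Aff.smul_fst, Aff.smul_snd, map_smul, Pi.smul_apply,
      smul_eq_mul, RingHom.id_apply]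
    module
  · simp only [hc]
    simp only [LieAlgebra.Prod.bracket_apply, Aff.lie_fst, Aff.lie_snd, Pi.zero_apply,
      lie_add, add_lie, smul_lie, lie_smul, lie_self, h₁₂, h₂₁, h₃, h₄, h₃', h₄']
    module
  · obtain ⟨h1, h2, h3, h4⟩ := linearIndependent_four_iff.1 hli _ _ _ _ hp
    refine Prod.ext (Aff.ext h1 h2) (?_ : c p = 0)
    ext i
    fin_cases i
    · exact h3
    · exact h4

/-- This is the table of `aff(ℝ × ℝ)`, with `e₃, e₄` in the first summand and `e₁, e₂` in the
second; the signs suit `⁅a, J b⁆ = -(b · a)` on the derived algebra. -/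
theorem nonempty_lieEquiv_S₈ (hs : Module.finrank ℝ s = 4)
    (hli : LinearIndependent ℝ ![e₁, e₂, e₃, e₄]) (h₁₂ : ⁅e₁, e₂⁆ = 0) (h₁₃ : ⁅e₁, e₃⁆ = -e₁)
    (h₁₄ : ⁅e₁, e₄⁆ = 0) (h₂₃ : ⁅e₂, e₃⁆ = 0) (h₂₄ : ⁅e₂, e₄⁆ = -e₂) (h₃₄ : ⁅e₃, e₄⁆ = 0) :
    Nonempty (s ≃ₗ⁅ℝ⁆ S₈) := by
  have h₂₁ : ⁅e₂, e₁⁆ = 0 := by rw [← lie_skew, h₁₂, neg_zero]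
  have h₃₁ : ⁅e₃, e₁⁆ = e₁ := by rw [← lie_skew, h₁₃, neg_neg]
  have h₄₁ : ⁅e₄, e₁⁆ = 0 := by rw [← lie_skew, h₁₄, neg_zero]
  have h₃₂ : ⁅e₃, e₂⁆ = 0 := by rw [← lie_skew, h₂₃, neg_zero]
  have h₄₂ : ⁅e₄, e₂⁆ = e₂ := by rw [← lie_skew, h₂₄, neg_neg]
  have h₄₃ : ⁅e₄, e₃⁆ = 0 := by rw [← lie_skew, h₃₄, neg_zero]
  refine nonempty_lieEquiv_of_injective hs finrank_S₈
    { toFun := fun p => p.1.snd • e₁ + p.2.snd • e₂ + p.1.fst • e₃ + p.2.fst • e₄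
      map_add' := fun p q => ?_
      map_smul' := fun r p => ?_
      map_lie' := fun {p q} => ?_ } fun p hp => ?_
  · simp only [Prod.fst_add, Prod.snd_add, Aff.add_fst, Aff.add_snd]
    module
  · simp only [Prod.smul_fst, Prod.smul_snd, Aff.smul_fst, Aff.smul_snd, smul_eq_mul,
      RingHom.id_apply]
    module
  · simp only [LieAlgebra.Prod.bracket_apply, Aff.lie_fst, Aff.lie_snd, lie_add, add_lie,
      smul_lie, lie_smul, lie_self, h₁₂, h₁₃, h₁₄, h₂₃, h₂₄, h₃₄, h₂₁, h₃₁, h₄₁, h₃₂, h₄₂, h₄₃]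
    module
  · obtain ⟨h1, h2, h3, h4⟩ := linearIndependent_four_iff.1 hli _ _ _ _ hp
    exact Prod.ext (Aff.ext h3 h1) (Aff.ext h4 h2)

/-- The table of `aff(ℝ[ε])`: `e₂` and `e₄` are `ε` times `e₁` and `e₃`. -/
theorem nonempty_lieEquiv_S₉ (hs : Module.finrank ℝ s = 4)
    (hli : LinearIndependent ℝ ![e₁, e₂, e₃, e₄]) (h₁₂ : ⁅e₁, e₂⁆ = 0) (h₁₃ : ⁅e₁, e₃⁆ = -e₁)
    (h₁₄ : ⁅e₁, e₄⁆ = -e₂) (h₂₃ : ⁅e₂, e₃⁆ = -e₂) (h₂₄ : ⁅e₂, e₄⁆ = 0) (h₃₄ : ⁅e₃, e₄⁆ = 0) :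
    Nonempty (s ≃ₗ⁅ℝ⁆ S₉) := by
  have h₂₁ : ⁅e₂, e₁⁆ = 0 := by rw [← lie_skew, h₁₂, neg_zero]
  have h₃₁ : ⁅e₃, e₁⁆ = e₁ := by rw [← lie_skew, h₁₃, neg_neg]
  have h₄₁ : ⁅e₄, e₁⁆ = e₂ := by rw [← lie_skew, h₁₄, neg_neg]
  have h₃₂ : ⁅e₃, e₂⁆ = e₂ := by rw [← lie_skew, h₂₃, neg_neg]
  have h₄₂ : ⁅e₄, e₂⁆ = 0 := by rw [← lie_skew, h₂₄, neg_zero]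
  have h₄₃ : ⁅e₄, e₃⁆ = 0 := by rw [← lie_skew, h₃₄, neg_zero]
  refine nonempty_lieEquiv_of_injective hs finrank_S₉
    { toFun := fun p => p.right.snd • e₁ + (S₉.toAff p).snd • e₂ + p.right.fst • e₃ +
        (S₉.toAff p).fst • e₄
      map_add' := fun p q => ?_
      map_smul' := fun r p => ?_
      map_lie' := fun {p q} => ?_ } fun p hp => ?_
  · simp only [S₉.toAff_add, S₉.right_add, Aff.add_fst, Aff.add_snd]
    module
  · simp only [S₉.toAff_smul, S₉.right_smul, Aff.smul_fst, Aff.smul_snd, smul_eq_mul,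
      RingHom.id_apply]
    module
  · simp only [S₉.toAff_lie, S₉.right_lie, Aff.sub_fst, Aff.sub_snd, Aff.lie_fst, Aff.lie_snd,
      lie_add, add_lie, smul_lie, lie_smul, lie_self, h₁₂, h₁₃, h₁₄, h₂₃, h₂₄, h₃₄, h₂₁, h₃₁,
      h₄₁, h₃₂, h₄₂, h₄₃]
    module
  · obtain ⟨h1, h2, h3, h4⟩ := linearIndependent_four_iff.1 hli _ _ _ _ hp
    exact LieAlgebra.SemiDirectSum.ext (Aff.ext h4 h2 : S₉.toAff p = 0) (Aff.ext h3 h1)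

theorem nonempty_lieEquiv_S₁₁ (hs : Module.finrank ℝ s = 4)
    (hli : LinearIndependent ℝ ![e₁, e₂, e₃, e₄]) (h₁₂ : ⁅e₁, e₂⁆ = 0) (h₁₃ : ⁅e₁, e₃⁆ = -e₁)
    (h₁₄ : ⁅e₁, e₄⁆ = -e₂) (h₂₃ : ⁅e₂, e₃⁆ = -e₂) (h₂₄ : ⁅e₂, e₄⁆ = e₁) (h₃₄ : ⁅e₃, e₄⁆ = 0) :
    Nonempty (s ≃ₗ⁅ℝ⁆ S₁₁) := by
  have h₂₁ : ⁅e₂, e₁⁆ = 0 := by rw [← lie_skew, h₁₂, neg_zero]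
  have h₃₁ : ⁅e₃, e₁⁆ = e₁ := by rw [← lie_skew, h₁₃, neg_neg]
  have h₄₁ : ⁅e₄, e₁⁆ = e₂ := by rw [← lie_skew, h₁₄, neg_neg]
  have h₃₂ : ⁅e₃, e₂⁆ = e₂ := by rw [← lie_skew, h₂₃, neg_neg]
  have h₄₂ : ⁅e₄, e₂⁆ = -e₁ := by rw [← lie_skew, h₂₄]
  have h₄₃ : ⁅e₄, e₃⁆ = 0 := by rw [← lie_skew, h₃₄, neg_zero]
  refine nonempty_lieEquiv_of_injective hs finrank_S₁₁
    { toFun := fun p => p.snd.re • e₁ + p.snd.im • e₂ + p.fst.re • e₃ + p.fst.im • e₄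
      map_add' := fun p q => ?_
      map_smul' := fun r p => ?_
      map_lie' := fun {p q} => ?_ } fun p hp => ?_
  · simp only [Aff.add_fst, Aff.add_snd, Complex.add_re, Complex.add_im]
    module
  · simp only [Aff.smul_fst, Aff.smul_snd, Complex.smul_re, Complex.smul_im, smul_eq_mul,
      RingHom.id_apply]
    module
  · simp only [Aff.lie_fst, Aff.lie_snd, Complex.sub_re, Complex.sub_im, Complex.mul_re,
      Complex.mul_im, lie_add, add_lie, smul_lie, lie_smul, lie_self, h₁₂, h₁₃, h₁₄, h₂₃, h₂₄,
      h₃₄, h₂₁, h₃₁, h₄₁, h₃₂, h₄₂, h₄₃]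
    module
  · obtain ⟨h1, h2, h3, h4⟩ := linearIndependent_four_iff.1 hli _ _ _ _ hp
    exact Aff.ext (Complex.ext h3 h4) (Complex.ext h1 h2)

end Recognition

/-! ### Two-dimensional commutative algebras. -/

/-- A two-dimensional real commutative associative algebra without annihilator is `ℝ × ℝ`,
`ℝ[ε]` or `ℂ`. -/
theorem exists_basis_of_commutative_algebra {V : Type*} [AddCommGroup V] [Module ℝ V]
    (hV : Module.finrank ℝ V = 2) (m : V →ₗ[ℝ] V →ₗ[ℝ] V) (hcomm : ∀ a b, m a b = m b a)
    (hassoc : ∀ a b c, m a (m b c) = m b (m a c)) (hann : ∀ a, (∀ b, m a b = 0) → a = 0) :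
    ∃ e f, LinearIndependent ℝ ![e, f] ∧ m e e = e ∧
      (m e f = 0 ∧ m f f = f ∨ m e f = f ∧ (m f f = 0 ∨ m f f = -e)) := by
  have : FiniteDimensional ℝ V := Module.finite_of_finrank_pos (by omega)
  -- If all squares vanished, polarization would make the product zero.
  obtain ⟨a, ha⟩ : ∃ a, m a a ≠ 0 := by
    by_contra! h
    have h0 : ∀ a : V, a = 0 := fun a => hann a fun b => by
      have h1 := h (a + b)
      simp only [map_add, LinearMap.add_apply, h, hcomm b a, zero_add, add_zero] at h1
      rwa [← two_smul ℝ, smul_eq_zero_iff_right two_ne_zero] at h1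
    have : Subsingleton V := ⟨fun x y => (h0 x).trans (h0 y).symm⟩
    rw [Module.finrank_zero_of_subsingleton] at hV
    omega
  by_cases hinj : Function.Injective (m a)
  · have hsurj := LinearMap.injective_iff_surjective.1 hinj
    -- When `a` is not a zero divisor, the solution of `a e = a` is a unit, since every element is a
    -- multiple of `a`.
    obtain ⟨e, he⟩ := hsurj a
    have hone : ∀ b, m e b = b := fun b => by
      obtain ⟨c, rfl⟩ := hsurj b
      rw [hcomm a c, hassoc, hcomm e a, he]
    have he0 : e ≠ 0 := by
      rintro rfl
      rw [map_zero] at he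
      simp [← he] at ha
    obtain ⟨t, ht⟩ : ∃ t, LinearIndependent ℝ ![e, t] :=
      exists_linearIndependent_pair_of_one_lt_finrank (by omega) he0
    obtain ⟨α, β, hαβ⟩ := ht.exists_eq_of_finrank_eq_two hV (m t t)
    have ht' := LinearIndependent.pair_iff.1 ht
    -- Completing the square makes `u²` a multiple of `e`; its sign decides between `ℂ`, `ℝ[ε]` and
    -- `ℝ × ℝ`.
    set u := t - (β / 2) • e with hu
    have hli : ∀ c d : ℝ, c • e + d • u = 0 → c = 0 ∧ d = 0 := fun c d h => by
      obtain ⟨h1, h2⟩ := ht' (c - d * (β / 2)) d (by rw [← h, hu]; module)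
      subst h2
      simpa using h1
    have huu : m u u = (α + β ^ 2 / 4) • e := by
      simp only [hu, map_sub, map_smul, LinearMap.sub_apply, LinearMap.smul_apply, hone, hαβ,
        hcomm t e]
      module
    rcases lt_trichotomy (α + β ^ 2 / 4) 0 with hγ | hγ | hγ
    · have hr : 0 < √(-(α + β ^ 2 / 4)) := Real.sqrt_pos.2 (by linarith)
      have hr2 : √(-(α + β ^ 2 / 4)) ^ 2 = -(α + β ^ 2 / 4) := Real.sq_sqrt (by linarith)
      set r := √(-(α + β ^ 2 / 4))
      refine ⟨e, r⁻¹ • u, LinearIndependent.pair_iff.2 fun c d h => ?_, hone e,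
        .inr ⟨hone _, .inr ?_⟩⟩
      · rw [smul_smul] at h
        simpa [hr.ne'] using hli _ _ h
      · simp only [map_smul, LinearMap.smul_apply, huu, smul_smul]
        rw [← neg_one_smul ℝ e]
        congr 1
        field_simp
        linarith
    · exact ⟨e, u, LinearIndependent.pair_iff.2 hli, hone e,
        .inr ⟨hone _, .inl (by rw [huu, hγ, zero_smul])⟩⟩
    · have hr : 0 < √(α + β ^ 2 / 4) := Real.sqrt_pos.2 hγ
      have hr2 : √(α + β ^ 2 / 4) ^ 2 = α + β ^ 2 / 4 := Real.sq_sqrt hγ.le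
      set r := √(α + β ^ 2 / 4)
      obtain ⟨v, hv⟩ : ∃ v, v = r⁻¹ • u := ⟨_, rfl⟩
      have hvv : m v v = e := by
        simp only [hv, map_smul, LinearMap.smul_apply, huu, smul_smul, ← hr2]
        rw [show r⁻¹ * (r⁻¹ * r ^ 2) = 1 by field_simp, one_smul]
      -- As `v² = e`, these are orthogonal idempotents.
      refine ⟨(1 / 2 : ℝ) • (e + v), (1 / 2 : ℝ) • (e - v),
        LinearIndependent.pair_iff.2 fun c d h => ?_, ?_, .inl ⟨?_, ?_⟩⟩
      · obtain ⟨h1, h2⟩ := hli (c / 2 + d / 2) ((c / 2 - d / 2) * r⁻¹) (by rw [← h, hv]; module)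
        have h2 := (mul_eq_zero.1 h2).resolve_right (inv_ne_zero hr.ne')
        constructor <;> linarith
      all_goals
        simp only [map_add, map_sub, map_smul, LinearMap.add_apply, LinearMap.sub_apply,
          LinearMap.smul_apply, hone, hvv, hcomm v e]
        module
  -- When `a k = 0`, associativity forces `a²` and `k²` to be multiples of `a` and `k`; rescaling
  -- gives orthogonal idempotents.
  · obtain ⟨k, hk, hk0⟩ : ∃ k, m a k = 0 ∧ k ≠ 0 := by
      simpa [injective_iff_map_eq_zero] using hinj
    have hli : LinearIndependent ℝ ![a, k] := by
      refine LinearIndependent.pair_iff.2 fun c d h => ?_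
      have hc : c = 0 := by
        have := congrArg (m a) h
        simpa [hk, ha] using this
      subst hc
      simpa [hk0] using h
    obtain ⟨p, q, hpq⟩ := hli.exists_eq_of_finrank_eq_two hV (m a a)
    obtain ⟨r, t, hrt⟩ := hli.exists_eq_of_finrank_eq_two hV (m k k)
    have hka : m k a = 0 := by rw [hcomm, hk]
    have hkk : m k k ≠ 0 := fun h => hk0 <| hann k fun b => by
      obtain ⟨c, d, rfl⟩ := hli.exists_eq_of_finrank_eq_two hV b
      simp [h, hka]
    have hq : q = 0 := by
      have h1 := hassoc k a a
      rw [hka, hpq] at h1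
      simpa [hka, hkk] using h1
    have hr : r = 0 := by
      have h1 := hassoc a k k
      rw [hk, hrt] at h1
      simpa [hk, ha] using h1
    subst hq hr
    rw [zero_smul, add_zero] at hpq
    rw [zero_smul, zero_add] at hrt
    have hp : p ≠ 0 := by
      rintro rfl
      simp [hpq] at ha
    have ht : t ≠ 0 := by
      rintro rfl
      simp [hrt] at hkk
    refine ⟨p⁻¹ • a, t⁻¹ • k, LinearIndependent.pair_iff.2 fun c d h => ?_, ?_, .inl ⟨?_, ?_⟩⟩
    · rw [smul_smul, smul_smul] at h
      simpa [hp, ht] using LinearIndependent.pair_iff.1 hli _ _ h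
    · simp [hpq, hp]
    · simp [hk]
    · simp [hrt, ht]

/-! ### Case analysis on the center and the derived algebra. -/

namespace IsAbelianComplexStructure

variable {s : Type*} [LieRing s] [LieAlgebra ℝ s] {J : s →ₗ[ℝ] s}

theorem smul_add_smul_eq_zero (hJ : IsAbelianComplexStructure J) {v : s} (hv : v ≠ 0) {c d : ℝ}
    (h : c • v + d • J v = 0) : c = 0 ∧ d = 0 := by
  have h1 : (c * c + d * d) • v = 0 := by
    have h2 := congrArg J h
    simp only [map_add, map_smul, hJ.sq, map_zero] at h2
    have : (c * c + d * d) • v = c • (c • v + d • J v) - d • (c • J v + d • -v) := by module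
    rw [this, h, h2, smul_zero, smul_zero, sub_zero]
  exact mul_self_add_mul_self_eq_zero.1 ((smul_eq_zero_iff_left hv).1 h1)

/-- `J` makes `s` a complex vector space; a relation `(a + b i) x + (c + d i) v = 0` is solved for
`x` by multiplying by `a - b i`. -/
theorem linearIndependent (hJ : IsAbelianComplexStructure J) {x v : s} (hv : v ≠ 0)
    (hx : ∀ c d : ℝ, x ≠ c • v + d • J v) : LinearIndependent ℝ ![x, J x, v, J v] := by
  refine linearIndependent_four_iff.2 fun a b c d h => ?_
  have h1 : (a * a + b * b) • x = (-(a * c + b * d)) • v + (b * c - a * d) • J v := by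
    have h2 := congrArg J h
    simp only [map_add, map_smul, hJ.sq, map_zero] at h2
    have : (a * a + b * b) • x - ((-(a * c + b * d)) • v + (b * c - a * d) • J v) =
        a • (a • x + b • J x + c • v + d • J v) -
          b • (a • J x + b • -x + c • J v + d • -v) := by module
    rw [h, h2, smul_zero, smul_zero, sub_zero] at this
    exact sub_eq_zero.1 this
  by_cases hab : a * a + b * b = 0
  · obtain ⟨rfl, rfl⟩ := mul_self_add_mul_self_eq_zero.1 hab
    simp only [zero_smul, zero_add] at h
    simpa using hJ.smul_add_smul_eq_zero hv h
  · refine absurd ?_ (hx ((a * a + b * b)⁻¹ * (-(a * c + b * d)))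
      ((a * a + b * b)⁻¹ * (b * c - a * d)))
    rw [mul_smul, mul_smul, ← smul_add, ← h1, smul_smul, inv_mul_cancel₀ hab, one_smul]

theorem lie_map_eq_zero (hJ : IsAbelianComplexStructure J) {v : s} (hv : ∀ y : s, ⁅v, y⁆ = 0)
    (y : s) : ⁅J v, y⁆ = 0 := by
  rw [hJ.lie_left, hv, neg_zero]

/-- The form `⁅x, J y⁆` is symmetric, so it vanishes if it does on the diagonal; as `J` is onto, the
bracket would then be zero. -/
theorem exists_lie_map_ne_zero (hJ : IsAbelianComplexStructure J) (h : ∃ x y : s, ⁅x, y⁆ ≠ 0) :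
    ∃ x : s, ⁅x, J x⁆ ≠ 0 := by
  by_contra! h0
  have key : ∀ x y : s, ⁅x, J y⁆ = 0 := fun x y => by
    have h1 := h0 (x + y)
    rw [map_add, add_lie, lie_add, lie_add, h0, h0, zero_add, add_zero, ← lie_skew y,
      hJ.lie_left x y, neg_neg, ← two_smul ℝ] at h1
    exact (smul_eq_zero_iff_right two_ne_zero).1 h1
  obtain ⟨x, y, hxy⟩ := h
  have := key x (J y)
  rw [hJ.sq, lie_neg, neg_eq_zero] at this
  exact hxy this

/-- With `v` and `J v` central and `x, J x, v, J v` a basis, all brackets are multiples of `⁅x, J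
x⁆`. -/
theorem nonempty_lieEquiv_S₁_or_S₂ (hJ : IsAbelianComplexStructure J)
    (hs : Module.finrank ℝ s = 4) (hne : ∃ x y : s, ⁅x, y⁆ ≠ 0)
    (hz : ∃ v : s, v ≠ 0 ∧ ∀ y : s, ⁅v, y⁆ = 0) :
    Nonempty (s ≃ₗ⁅ℝ⁆ S₁) ∨ Nonempty (s ≃ₗ⁅ℝ⁆ S₂) := by
  obtain ⟨x, hx⟩ := hJ.exists_lie_map_ne_zero hne
  have hli : ∀ v : s, v ≠ 0 → (∀ y : s, ⁅v, y⁆ = 0) →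
      LinearIndependent ℝ ![x, J x, v, J v] := fun v hv0 hv => by
    refine hJ.linearIndependent hv0 fun c d h => hx ?_
    rw [congrArg (fun t => ⁅t, J x⁆) h]
    simp [hv, hJ.lie_map_eq_zero hv]
  by_cases hc : ∀ y : s, ⁅⁅x, J x⁆, y⁆ = 0
  · exact .inl (nonempty_lieEquiv_S₁ hs (hli _ hx hc) rfl hc (hJ.lie_map_eq_zero hc))
  · right
    obtain ⟨v, hv0, hv⟩ := hz
    have hv' := hJ.lie_map_eq_zero hv
    have hvr : ∀ y : s, ⁅y, v⁆ = 0 := fun y => by rw [← lie_skew, hv, neg_zero]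
    have hvr' : ∀ y : s, ⁅y, J v⁆ = 0 := fun y => by rw [← lie_skew, hv', neg_zero]
    obtain ⟨a, b, c, d, habcd⟩ := (hli v hv0 hv).exists_eq_of_finrank_eq_four hs ⁅x, J x⁆
    set u := ⁅x, J x⁆ with hu
    have hxu : ⁅x, u⁆ = b • u := by
      rw [habcd]; simp only [lie_add, lie_smul, lie_self, hvr, hvr', ← hu]; rw [← habcd]; module
    have hJxu : ⁅J x, u⁆ = -a • u := by
      rw [habcd]
      simp only [lie_add, lie_smul, lie_self, hvr, hvr']
      rw [← lie_skew, ← hu, ← habcd]; module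
    have hab : a * a + b * b ≠ 0 := fun h => hc fun y => by
      obtain ⟨rfl, rfl⟩ := mul_self_add_mul_self_eq_zero.1 h
      rw [habcd]
      simp [hv, hv']
    -- `x` and `J x` act on `u` by `b` and `-a`, so this combination acts by `1`.
    have hyu : ⁅(a * a + b * b)⁻¹ • (b • x - a • J x), u⁆ = u := by
      rw [smul_lie, sub_lie, smul_lie, smul_lie, hxu, hJxu, inv_smul_eq_iff₀ hab]
      module
    refine nonempty_lieEquiv_S₂ hs (linearIndependent_four_iff.2 fun p q r t h => ?_) hyu hv hv'
    have hp : p = 0 := by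
      have := congrArg (fun w => ⁅w, u⁆) h
      simp only [add_lie, smul_lie p, hyu, smul_lie q, smul_lie r, smul_lie t, lie_self, hv, hv',
        smul_zero, add_zero, zero_lie] at this
      exact (smul_eq_zero_iff_left hx).1 this
    have hq : q = 0 := by
      have := congrArg (fun w => ⁅(a * a + b * b)⁻¹ • (b • x - a • J x), w⁆) h
      simp only [lie_add, lie_smul, hyu, lie_self, hvr, hvr',
        smul_zero, add_zero, zero_add, lie_zero] at this
      exact (smul_eq_zero_iff_left hx).1 this
    subst hp hq
    simp only [zero_smul, zero_add] at h
    simpa using hJ.smul_add_smul_eq_zero hv0 h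

/-- The case of a derived algebra which meets its image under `J`, for a trivial center. -/
theorem nonempty_lieEquiv_S₁₁ (hJ : IsAbelianComplexStructure J) (hs : Module.finrank ℝ s = 4)
    (hz : ∀ v : s, (∀ y : s, ⁅v, y⁆ = 0) → v = 0) (D : Submodule ℝ s)
    (hD : ∀ x y : s, ⁅x, y⁆ ∈ D) (hDD : ∀ x ∈ D, ∀ y ∈ D, ⁅x, y⁆ = 0) {u : s} (hu0 : u ≠ 0)
    (hu : u ∈ D) (hJu : J u ∈ D) : Nonempty (s ≃ₗ⁅ℝ⁆ S₁₁) := by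
  have hspan : ∀ w ∈ D, ∃ c d : ℝ, w = c • u + d • J u := by
    intro w hw
    -- Otherwise `w, J w, u, J u` is a basis each of whose members commutes with `u`, by `⁅u, J w⁆ =
    -- -⁅J u, w⁆ = 0`.
    by_contra! h
    refine hu0 (hz u fun y => ?_)
    obtain ⟨a, b, c, d, rfl⟩ := (hJ.linearIndependent hu0 h).exists_eq_of_finrank_eq_four hs y
    have h1 : ⁅u, J w⁆ = 0 := by
      have := hJ.lie_left u w
      rw [hDD _ hJu _ hw] at this
      exact neg_eq_zero.1 this.symm
    simp [hDD _ hu _ hw, hDD _ hu _ hJu, h1]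
  obtain ⟨x, hx⟩ : ∃ x : s, ⁅x, u⁆ ≠ 0 := by
    by_contra! h
    exact hu0 (hz u fun y => by rw [← lie_skew, h, neg_zero])
  obtain ⟨a, b, hxu⟩ := hspan _ (hD x u)
  obtain ⟨c, d, hxJu⟩ := hspan _ (hD x (J u))
  have hJxu : ⁅J x, u⁆ = -(c • u + d • J u) := by rw [hJ.lie_left, hxJu]
  have hJxJu : ⁅J x, J u⁆ = a • u + b • J u := by rw [hJ.lie, hxu]
  -- `ad x` is complex linear on `D`: since `⁅x, J x⁆` kills `D`, `ad x` and `ad (J x)` commute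
  -- there, and two of the resulting equations add up to `(a - d)² + (b + c)² = 0`.
  have hadbc : a = d ∧ c = -b := by
    have h1 := leibniz_lie x (J x) u
    have h2 := leibniz_lie x (J x) (J u)
    rw [hDD _ (hD x (J x)) _ hu, zero_add] at h1
    rw [hDD _ (hD x (J x)) _ hJu, zero_add] at h2
    simp only [hxu, hxJu, hJxu, hJxJu, lie_neg, lie_add, lie_smul] at h1 h2
    have k1 := (hJ.smul_add_smul_eq_zero hu0 (c := d * c + a * b)
      (d := b ^ 2 + b * c + d ^ 2 - a * d)
      (by rw [← sub_eq_zero] at h1; rw [← neg_zero, ← h1]; module)).2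
    have k2 := (hJ.smul_add_smul_eq_zero hu0
      (c := a ^ 2 + b * c + c ^ 2 - a * d) (d := a * b + c * d)
      (by rw [← sub_eq_zero] at h2; rw [← h2]; module)).1
    constructor <;> nlinarith [sq_nonneg (a - d), sq_nonneg (b + c)]
  obtain ⟨rfl, rfl⟩ := hadbc
  have hn : a * a + b * b ≠ 0 := fun h => hx <| by
    obtain ⟨rfl, rfl⟩ := mul_self_add_mul_self_eq_zero.1 h
    simp [hxu]
  obtain ⟨y, hyu, hyJu⟩ : ∃ y : s, ⁅y, u⁆ = u ∧ ⁅y, J u⁆ = J u := by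
    -- On `D`, `x` acts as `a + b i` and `J x` as `b - a i`.
    refine ⟨(a * a + b * b)⁻¹ • (a • x + b • J x), ?_, ?_⟩ <;>
    · simp only [smul_lie (a * a + b * b)⁻¹, add_lie, smul_lie a, smul_lie b, hxu, hxJu, hJxu,
        hJxJu]
      rw [inv_smul_eq_iff₀ hn]
      module
  obtain ⟨α, β, hαβ⟩ := hspan _ (hD y (J y))
  have hJyu : ⁅J y, u⁆ = -J u := by rw [hJ.lie_left, hyJu]
  have hJyJu : ⁅J y, J u⁆ = u := by rw [hJ.lie, hyu]
  have huJu : ⁅u, J u⁆ = 0 := hDD _ hu _ hJu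
  have hJuu : ⁅J u, u⁆ = 0 := hDD _ hJu _ hu
  -- Adding `w ∈ D` to `y` keeps the action on `D` and changes `⁅y, J y⁆` by `2 J w`; this `w` makes
  -- the result zero.
  obtain ⟨z, hz⟩ : ∃ z, z = y + (1 / 2 : ℝ) • (α • J u - β • u) := ⟨_, rfl⟩
  have hzu : ⁅z, u⁆ = u := by simp [hz, hyu, hJuu]
  have hzJu : ⁅z, J u⁆ = J u := by simp [hz, hyJu, huJu]
  have hJzu : ⁅J z, u⁆ = -J u := by rw [hJ.lie_left, hzJu]
  have hJzJu : ⁅J z, J u⁆ = u := by rw [hJ.lie, hzu]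
  have hzJz : ⁅z, J z⁆ = 0 := by
    have h1 : J z = J y - (1 / 2 : ℝ) • (α • u + β • J u) := by
      simp only [hz, map_add, map_smul, map_sub, hJ.sq]; module
    have h2 : ⁅z, J y⁆ = (1 / 2 : ℝ) • (α • u + β • J u) := by
      rw [← lie_skew, hz]
      simp only [lie_add, lie_sub, lie_smul, hJyu, hJyJu]
      rw [← lie_skew, hαβ]
      module
    rw [h1, lie_sub, h2, lie_smul, lie_add, lie_smul, lie_smul, hzu, hzJu, sub_self]
  have hli := hJ.linearIndependent hu0 (x := z) fun p q h => hu0 <| by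
    have h1 : ⁅z, u⁆ = 0 := by rw [h]; simp [hJuu]
    rw [← hzu, h1]
  -- `z` acts on `D` as `1` and `-J z` as `i`.
  refine _root_.nonempty_lieEquiv_S₁₁ (e₁ := u) (e₂ := J u) (e₃ := z) (e₄ := -J z) hs
    (linearIndependent_four_iff.2 fun p q r t h => ?_) huJu ?_ ?_ ?_ ?_ ?_
  · obtain ⟨h1, h2, h3, h4⟩ := linearIndependent_four_iff.1 hli r (-t) p q (by rw [← h]; module)
    exact ⟨h3, h4, h1, neg_eq_zero.1 h2⟩
  · rw [← lie_skew, hzu]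
  · rw [lie_neg, ← lie_skew, hJzu, neg_neg]
  · rw [← lie_skew, hzJu]
  · rw [lie_neg, ← lie_skew, hJzJu, neg_neg]
  · rw [lie_neg, hzJz, neg_zero]

/-- If the derived algebra is a line, then the center is not trivial. -/
theorem _root_.exists_central_of_lie_mem_line {s : Type*} [LieRing s] [LieAlgebra ℝ s]
    (hs : Module.finrank ℝ s = 4) {u : s} (hu : ∀ x y : s, ∃ c : ℝ, c • u = ⁅x, y⁆) :
    ∃ v : s, v ≠ 0 ∧ ∀ y : s, ⁅v, y⁆ = 0 := by
  have : FiniteDimensional ℝ s := Module.finite_of_finrank_pos (by omega)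
  rcases eq_or_ne u 0 with rfl | hu0
  · have : Nontrivial s := Module.nontrivial_of_finrank_pos (R := ℝ) (by omega)
    obtain ⟨v, hv⟩ := exists_ne (0 : s)
    refine ⟨v, hv, fun y => ?_⟩
    obtain ⟨c, hc⟩ := hu v y
    rw [← hc, smul_zero]
  by_cases hc : ∀ y : s, ⁅u, y⁆ = 0
  · exact ⟨u, hu0, hc⟩
  push Not at hc
  obtain ⟨y, hy⟩ := hc
  obtain ⟨c, hc⟩ := hu u y
  have hc0 : c ≠ 0 := by
    rintro rfl
    exact hy (by rw [← hc, zero_smul])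
  have hyu : ⁅y, u⁆ = -c • u := by rw [← lie_skew, ← hc]; module
  let φ : s →ₗ[ℝ] s := LieAlgebra.ad ℝ s y
  let ψ : s →ₗ[ℝ] s := LieAlgebra.ad ℝ s u
  have hmem : ∀ x y : s, ⁅x, y⁆ ∈ Submodule.span ℝ {u} := fun x y =>
    Submodule.mem_span_singleton.2 (hu x y)
  -- The kernel is nonzero by dimension. An element `v` of it commutes with `y` and `u`, and Jacobi
  -- for `v, y, w` then gives `⁅y, ⁅v, w⁆⁆ = 0`, which forces `⁅v, w⁆ = 0`.
  let f : s →ₗ[ℝ] Submodule.span ℝ {u} × Submodule.span ℝ {u} :=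
    (φ.codRestrict _ (hmem y)).prod (ψ.codRestrict _ (hmem u))
  have hker : LinearMap.ker f ≠ ⊥ := by
    refine LinearMap.ker_ne_bot_of_finrank_lt ?_
    rw [Module.finrank_prod, finrank_span_singleton hu0, hs]
    norm_num
  have hf : ∀ w ∈ LinearMap.ker f, ⁅y, w⁆ = 0 ∧ ⁅u, w⁆ = 0 := fun w hw => by
    have h := LinearMap.mem_ker.1 hw
    exact ⟨congrArg (fun p => (p.1 : s)) h, congrArg (fun p => (p.2 : s)) h⟩
  obtain ⟨v, hv, hv0⟩ := Submodule.exists_mem_ne_zero_of_ne_bot hker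
  obtain ⟨hyv, huv⟩ := hf v hv
  refine ⟨v, hv0, fun w => ?_⟩
  obtain ⟨p, hp⟩ := hu v w
  have h1 := leibniz_lie v y w
  obtain ⟨q, hq⟩ := hu y w
  rw [← hq, ← hp, ← lie_skew v y, hyv, neg_zero, zero_lie, zero_add, lie_smul, lie_smul, hyu,
    ← lie_skew v u, huv, neg_zero, smul_zero, smul_smul] at h1
  rcases mul_eq_zero.1 ((smul_eq_zero_iff_left hu0).1 h1.symm) with h | h
  · rw [← hp, h, zero_smul]
  · exact absurd (neg_eq_zero.1 h) hc0

/-- The case of a derived algebra which is complementary to its image under `J`. -/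
theorem nonempty_lieEquiv_S₈_or_S₉_or_S₁₁ (hJ : IsAbelianComplexStructure J)
    (hs : Module.finrank ℝ s = 4) (hz : ∀ v : s, (∀ y : s, ⁅v, y⁆ = 0) → v = 0)
    (D : Submodule ℝ s) (hD : ∀ x y : s, ⁅x, y⁆ ∈ D) (hDD : ∀ x ∈ D, ∀ y ∈ D, ⁅x, y⁆ = 0)
    (hDJ : ∀ u ∈ D, J u ∈ D → u = 0) :
    Nonempty (s ≃ₗ⁅ℝ⁆ S₈) ∨ Nonempty (s ≃ₗ⁅ℝ⁆ S₉) ∨ Nonempty (s ≃ₗ⁅ℝ⁆ S₁₁) := by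
  have : FiniteDimensional ℝ s := Module.finite_of_finrank_pos (by omega)
  have hJinj : Function.Injective J := (injective_iff_map_eq_zero J).2 fun x hx => by
    have := hJ.sq x
    rw [hx, map_zero] at this
    exact neg_eq_zero.1 this.symm
  have hinf : D ⊓ D.map J = ⊥ := by
    refine (Submodule.eq_bot_iff _).2 fun w hw => ?_
    obtain ⟨hw, v, hv, rfl⟩ := hw
    rw [hDJ v hv hw, map_zero]
  have hdim := Submodule.finrank_sup_add_finrank_inf_eq D (D.map J)
  rw [hinf, finrank_bot, add_zero, ← (Submodule.equivMapOfInjective J hJinj D).finrank_eq] at hdim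
  have hle := Submodule.finrank_le (D ⊔ D.map J)
  have hD2 : Module.finrank ℝ D = 2 := by
    by_contra hne
    obtain ⟨u, hu⟩ := finrank_le_one_iff.1 (show Module.finrank ℝ D ≤ 1 by omega)
    obtain ⟨v, hv0, hv⟩ := exists_central_of_lie_mem_line (s := s) hs (u := u) fun x y => by
      obtain ⟨c, hc⟩ := hu ⟨_, hD x y⟩
      exact ⟨c, congrArg Subtype.val hc⟩
    exact hv0 (hz v hv)
  have htop : D ⊔ D.map J = ⊤ := Submodule.eq_top_of_finrank_eq (by omega)
  -- Commutativity is `⁅J a, b⁆ = -⁅a, J b⁆`; left multiplications commute because `⁅J a, J b⁆ = ⁅a,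
  -- b⁆ = 0`; an annihilator would be central since `s = D + J D`.
  let m : D →ₗ[ℝ] D →ₗ[ℝ] D := LinearMap.mk₂ ℝ (fun a b => ⟨⁅J a, (b : s)⁆, hD _ _⟩)
    (fun a b c => Subtype.ext (by simp)) (fun r a b => Subtype.ext (by simp))
    (fun a b c => Subtype.ext (by simp)) (fun r a b => Subtype.ext (by simp))
  have hm : ∀ a b : D, (m a b : s) = ⁅J a, (b : s)⁆ := fun _ _ => rfl
  have hcomm : ∀ a b : D, m a b = m b a := fun a b => Subtype.ext <| by
    rw [hm, hm, hJ.lie_left, lie_skew]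
  have hassoc : ∀ a b c : D, m a (m b c) = m b (m a c) := fun a b c => Subtype.ext <| by
    rw [hm, hm, hm, hm, leibniz_lie, hJ.lie, hDD _ a.2 _ b.2, zero_lie, zero_add]
  have hann : ∀ a : D, (∀ b, m a b = 0) → a = 0 := fun a ha => Subtype.ext <| hz a fun y => by
    obtain ⟨b, hb, _, ⟨c, hc, rfl⟩, rfl⟩ := Submodule.mem_sup.1 (htop ▸ Submodule.mem_top (x := y))
    have h1 : ⁅J a, c⁆ = 0 := congrArg Subtype.val (ha ⟨c, hc⟩)
    rw [hJ.lie_left, neg_eq_zero] at h1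
    rw [lie_add, hDD _ a.2 _ hb, h1, zero_add]
  obtain ⟨e, f, hli, hee, hcases⟩ :=
    exists_basis_of_commutative_algebra hD2 m hcomm hassoc hann
  have hli4 : LinearIndependent ℝ ![(e : s), (f : s), J e, J f] := by
    refine linearIndependent_four_iff.2 fun a b c d h => ?_
    have hpair := LinearIndependent.pair_iff.1 hli
    have h1 : c • e + d • f = 0 := by
      refine Subtype.ext (hDJ _ (c • e + d • f).2 ?_)
      have : J ↑(c • e + d • f) = ↑(-(a • e + b • f)) := by
        rw [← sub_eq_zero, ← h]
        simp only [Submodule.coe_add, Submodule.coe_smul, Submodule.coe_neg, map_add, map_smul]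
        module
      rw [this]
      exact Subtype.property _
    obtain ⟨rfl, rfl⟩ := hpair c d h1
    obtain ⟨ha, hb⟩ := hpair a b (Subtype.ext (by simpa using h))
    exact ⟨ha, hb, rfl, rfl⟩
  have hlie : ∀ a b c : D, m b a = c → ⁅(a : s), J b⁆ = -(c : s) := fun a b c h => by
    rw [← lie_skew, ← hm, h]
  have hef : ⁅(e : s), (f : s)⁆ = 0 := hDD _ e.2 _ f.2
  have hJef : ⁅J e, J f⁆ = 0 := by rw [hJ.lie, hef]
  rcases hcases with ⟨hef', hff⟩ | ⟨hef', hff | hff⟩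
  · refine .inl (nonempty_lieEquiv_S₈ hs hli4 hef (hlie _ _ _ hee) ?_ ?_ (hlie _ _ _ hff) hJef)
    · simpa using hlie _ _ _ ((hcomm _ _).trans hef')
    · simpa using hlie _ _ _ hef'
  · refine .inr (.inl (nonempty_lieEquiv_S₉ hs hli4 hef (hlie _ _ _ hee)
      (hlie _ _ _ ((hcomm _ _).trans hef')) (hlie _ _ _ hef') ?_ hJef))
    simpa using hlie _ _ _ hff
  · refine .inr (.inr (_root_.nonempty_lieEquiv_S₁₁ hs hli4 hef (hlie _ _ _ hee)
      (hlie _ _ _ ((hcomm _ _).trans hef')) (hlie _ _ _ hef') ?_ hJef))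
    simpa using hlie _ _ _ hff

/-- Four-dimensional Lie algebras with an abelian complex structure; `S₁₀` is omitted, being
isomorphic to `S₈`. -/
theorem classification (hJ : IsAbelianComplexStructure J) (hs : Module.finrank ℝ s = 4) :
    Nonempty (s ≃ₗ⁅ℝ⁆ S₀) ∨ Nonempty (s ≃ₗ⁅ℝ⁆ S₁) ∨ Nonempty (s ≃ₗ⁅ℝ⁆ S₂) ∨
      Nonempty (s ≃ₗ⁅ℝ⁆ S₈) ∨ Nonempty (s ≃ₗ⁅ℝ⁆ S₉) ∨ Nonempty (s ≃ₗ⁅ℝ⁆ S₁₁) := by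
  by_cases hab : ∀ x y : s, ⁅x, y⁆ = 0
  · exact .inl (nonempty_lieEquiv_S₀ hs hab)
  push Not at hab
  by_cases hz : ∃ v : s, v ≠ 0 ∧ ∀ y : s, ⁅v, y⁆ = 0
  · have := hJ.nonempty_lieEquiv_S₁_or_S₂ hs hab hz
    tauto
  have hz' : ∀ v : s, (∀ y : s, ⁅v, y⁆ = 0) → v = 0 := fun v hv => by
    by_contra hv0
    exact hz ⟨v, hv0, hv⟩
  let D : Submodule ℝ s := Submodule.span ℝ {z | ∃ x y : s, ⁅x, y⁆ = z}
  have hD : ∀ x y : s, ⁅x, y⁆ ∈ D := fun x y => Submodule.subset_span ⟨x, y, rfl⟩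
  have hDD : ∀ x ∈ D, ∀ y ∈ D, ⁅x, y⁆ = 0 := fun x hx y hy => by
    induction hx, hy using Submodule.span_induction₂ with
    | mem_mem x y hx hy =>
      obtain ⟨a, b, rfl⟩ := hx
      obtain ⟨c, d, rfl⟩ := hy
      exact hJ.lie_lie_lie_eq_zero a b c d
    | zero_left y hy => exact zero_lie y
    | zero_right x hx => exact lie_zero x
    | add_left x y z hx hy hz h1 h2 => rw [add_lie, h1, h2, add_zero]
    | add_right x y z hx hy hz h1 h2 => rw [lie_add, h1, h2, add_zero]
    | smul_left r x y hx hy h => rw [smul_lie, h, smul_zero]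
    | smul_right r x y hx hy h => rw [lie_smul, h, smul_zero]
  by_cases hDJ : ∃ u ∈ D, J u ∈ D ∧ u ≠ 0
  · obtain ⟨u, hu, hJu, hu0⟩ := hDJ
    have := hJ.nonempty_lieEquiv_S₁₁ hs hz' D hD hDD hu0 hu hJu
    tauto
  · push Not at hDJ
    have := hJ.nonempty_lieEquiv_S₈_or_S₉_or_S₁₁ hs hz' D hD hDD hDJ
    tauto

end IsAbelianComplexStructure

theorem proposition3p3 :
    -- modulo its center, every 4-dimensional Lie algebra with an abelian complex structure
    -- is `aff(A)` for some finite dimensional commutative associative algebra `A`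
    (∀ (s : Type*) [LieRing s] [LieAlgebra ℝ s], Module.finrank ℝ s = 4 →
      AdmitsAbelianComplexStructure s →
      ∃ (A : Type) (_ : NonUnitalCommRing A) (_ : Module ℝ A) (_ : IsScalarTower ℝ A A)
        (_ : SMulCommClass ℝ A A), FiniteDimensional ℝ A ∧ ModCenterIsAff s A) ∧
    -- the list of these Lie algebras
    (∀ (s : Type*) [LieRing s] [LieAlgebra ℝ s],
      (Module.finrank ℝ s = 4 ∧ AdmitsAbelianComplexStructure s) ↔
        (Nonempty (s ≃ₗ⁅ℝ⁆ S₀) ∨ Nonempty (s ≃ₗ⁅ℝ⁆ S₁) ∨ Nonempty (s ≃ₗ⁅ℝ⁆ S₂) ∨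
          Nonempty (s ≃ₗ⁅ℝ⁆ S₈) ∨ Nonempty (s ≃ₗ⁅ℝ⁆ S₉) ∨ Nonempty (s ≃ₗ⁅ℝ⁆ S₁₀) ∨
          Nonempty (s ≃ₗ⁅ℝ⁆ S₁₁))) ∧
    -- the algebra `A` for each entry of the list
    ModCenterIsAff S₀ (TrivialAlgebra PUnit.{1}) ∧
    ModCenterIsAff S₁ (TrivialAlgebra ℝ) ∧
    ModCenterIsAff S₂ ℝ ∧
    ((∀ a b : A₈, a * b = b * a) ∧ ModCenterIsAff S₈ A₈) ∧
    ((∀ a b : A₉, a * b = b * a) ∧ ModCenterIsAff S₉ A₉) ∧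
    ((∀ a b : A₁₀, a * b = b * a) ∧ ModCenterIsAff S₁₀ A₁₀) ∧
    ModCenterIsAff S₁₁ ℂ := by
  refine ⟨fun s _ _ hs hJ => ?_, fun s _ _ => ⟨?_, ?_⟩, modCenterIsAff_S₀, modCenterIsAff_S₁,
    modCenterIsAff_S₂, ⟨A₈_mul_comm, .of_lieEquiv_aff S₈EquivAff⟩,
    ⟨A₉_mul_comm, .of_lieEquiv_aff S₉EquivAff⟩, ⟨A₁₀_mul_comm, .of_lieEquiv_aff S₁₀EquivAff⟩,
    .of_lieEquiv_aff LieEquiv.refl⟩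
  · obtain ⟨J, hJ⟩ := hJ
    rcases hJ.classification hs with ⟨⟨e⟩⟩ | ⟨⟨e⟩⟩ | ⟨⟨e⟩⟩ | ⟨⟨e⟩⟩ | ⟨⟨e⟩⟩ | ⟨⟨e⟩⟩
    · exact ⟨TrivialAlgebra PUnit.{1}, inferInstance, inferInstance, inferInstance, inferInstance,
        inferInstanceAs (FiniteDimensional ℝ PUnit.{1}), modCenterIsAff_S₀.of_lieEquiv e⟩
    · exact ⟨TrivialAlgebra ℝ, inferInstance, inferInstance, inferInstance, inferInstance,
        inferInstanceAs (FiniteDimensional ℝ ℝ), modCenterIsAff_S₁.of_lieEquiv e⟩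
    · exact ⟨ℝ, inferInstance, inferInstance, inferInstance, inferInstance, inferInstance,
        modCenterIsAff_S₂.of_lieEquiv e⟩
    · exact ⟨A₈, A₈.nonUnitalCommRing A₈_mul_comm, inferInstance, inferInstance, inferInstance,
        inferInstance, .of_lieEquiv_aff (A := A₈) (e.trans S₈EquivAff)⟩
    · exact ⟨A₉, A₉.nonUnitalCommRing A₉_mul_comm, inferInstance, inferInstance, inferInstance,
        inferInstance, .of_lieEquiv_aff (A := A₉) (e.trans S₉EquivAff)⟩
    · exact ⟨ℂ, inferInstance, inferInstance, inferInstance, inferInstance, inferInstance,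
        .of_lieEquiv_aff e⟩
  · rintro ⟨hs, J, hJ⟩
    have := hJ.classification hs
    tauto
  · rintro (⟨⟨e⟩⟩ | ⟨⟨e⟩⟩ | ⟨⟨e⟩⟩ | ⟨⟨e⟩⟩ | ⟨⟨e⟩⟩ | ⟨⟨e⟩⟩ | ⟨⟨e⟩⟩)
    · exact ⟨e.toLinearEquiv.finrank_eq.trans finrank_S₀, admits_S₀.of_lieEquiv e⟩
    · exact ⟨e.toLinearEquiv.finrank_eq.trans finrank_S₁, admits_S₁.of_lieEquiv e⟩
    · exact ⟨e.toLinearEquiv.finrank_eq.trans finrank_S₂, admits_S₂.of_lieEquiv e⟩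
    · exact ⟨e.toLinearEquiv.finrank_eq.trans finrank_S₈, admits_S₈.of_lieEquiv e⟩
    · exact ⟨e.toLinearEquiv.finrank_eq.trans finrank_S₉, admits_S₉.of_lieEquiv e⟩
    · exact ⟨e.toLinearEquiv.finrank_eq.trans finrank_S₁₀, admits_S₁₀.of_lieEquiv e⟩
    · exact ⟨e.toLinearEquiv.finrank_eq.trans finrank_S₁₁, admits_S₁₁.of_lieEquiv e⟩
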